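/- **Setting.** There are $N$ jobs and $m$ identical parallel machines; jobs are processed non-preemptively. Each job $J\in\{1,\dots,N\}$ has one of two types; type $j$ has size $p_j$, where $p_1>p_2>0$. A job $J$ of type $j$ is *long* (processing time $p_j$) with probability $q_J\in(0,1]$ and *short* (processing time $0$) with probability $1-q_J$, independently of the other jobs; its processing time becomes known as soon as it is started. A non-anticipatory policy decides at each time, knowing only the partial schedule so far and the processing times of the jobs already started, whether to start a further job and, if so, which job on which free machine (several jobs may be started one after the other at the same time), and it produces a feasible schedule of all jobs on each realization (of positive probability). It is *non-idling* if no machine is idle at a time at which not all jobs have been started. Let $\varepsilon>0$. Put $l_0=0$, $l_{k+1}=p_1+k\varepsilon p_1$ and $l_k'=(1+5\varepsilon)l_k$ for $k\ge 0$, and $$Q_2^k=\{\,l_k'+i\varepsilon p_2 \mid i\in\mathbb N_0,\ l_k'+i\varepsilon p_2\le l_{k+1}'-p_2\,\},\qquad Q_2=\bigcup_{k\ge0}Q_2^k,\qquad Q_1=Q_2^0\cup\{\,l_k'\mid k\ge1\,\}.$$ A policy is *stratified with respect to $(Q_1,Q_2)$ and $(p_1,p_2)$* if on each realization: (i) each job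 of type $j$ starts at a time in $Q_j$; (ii) if a job of type $j$ is long and completes at time $c$, then no job is started on the same machine in $[c,t')$, where $t'=\min\{t\in Q_j\mid t\ge\max\{p_j,c\}\}$; (iii) jobs of the same type are started in order of index. **Theorem.** Let $0<\varepsilon\le 3/10$ with $1/\varepsilon$ an integer, and let $p_2\le\varepsilon^2p_1$. Then for every non-anticipatory non-idling policy $\Pi$ that starts jobs of the same type in order of index, there is a non-anticipatory (possibly idling) policy $\Pi'$ that is stratified with respect to $(Q_1,Q_2)$ and $(p_1,p_2)$ such that on each realization the start times $S_J$ under $\Pi$ and $S'_J$ under $\Pi'$ satisfy, for each job $J$, $$S_J'\le(1+3(1+\varepsilon)\varepsilon)(1+5\varepsilon)\,S_J .$$ Here $(1+3(1+\varepsilon)\varepsilon)(1+5\varepsilon)=1+O(\varepsilon)$ as $\varepsilon\to0$. -/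

import Mathlib

namespace TwoTypeScheduling

/-- The two job types. -/
inductive JobType where
  | one
  | two

/-- An input: `N` jobs on `m` identical parallel machines. Every job has one of two types with
size parameters `p₁ > p₂ > 0`; job `J` is long (processing time equal to the size of its type)
with probability `q J ∈ (0, 1]` and short (processing time `0`) otherwise, independently of the
other jobs. -/
structure Input where
  N : ℕ
  m : ℕ
  p₁ : ℝ
  p₂ : ℝ
  p₂_pos : 0 < p₂
  p₂_lt_p₁ : p₂ < p₁
  type : Fin N → JobType
  q : Fin N → ℝ
  q_pos : ∀ J, 0 < q J
  q_le_one : ∀ J, q J ≤ 1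

/-- The size parameter of a job type. -/
def Input.size (I : Input) : JobType → ℝ
  | .one => I.p₁
  | .two => I.p₂

/-- A realization tells for each job whether it is long (`true`) or short (`false`). -/
abbrev Input.Realization (I : Input) := Fin I.N → Bool

/-- The probability of a realization. -/
noncomputable def Input.prob (I : Input) (ω : I.Realization) : ℝ :=
  ∏ J, if ω J then I.q J else 1 - I.q J

/-- The record of a started job: machine, start time, and whether it turned out long. (The
processing time of a Bernoulli job is known as soon as the job is started.) -/
structure StartedJob (I : Input) where
  job : Fin I.N
  machine : Fin I.m
  start : ℝ
  long : Bool

/-- The completion time of a started job. -/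
noncomputable def StartedJob.completion {I : Input} (e : StartedJob I) : ℝ :=
  e.start + if e.long then I.size (I.type e.job) else 0

/-- A (partial) schedule: the jobs started so far, the most recently started one first.
Several jobs may be started, one after the other, at the same point in time. -/
abbrev Schedule (I : Input) := List (StartedJob I)

/-- A non-anticipatory decision rule maps a partial schedule and a decision time `t` to a decision
at time `t`: either `some (J, i)`, to start job `J` on machine `i` now, or `none`, to start nothing.
It is non-anticipatory because the only realizations it has access to are those of the jobs
already started. After a job was started at time `t`, the rule is applied to the extended
partial schedule, again from time `t` on. -/
abbrev DecisionRule (I : Input) := Schedule I → ℝ → Option (Fin I.N × Fin I.m)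

/-- `t` is a possible decision time for the partial schedule `h`. -/
def IsDecisionTime {I : Input} (h : Schedule I) (t : ℝ) : Prop :=
  0 ≤ t ∧ ∀ e ∈ h, e.start ≤ t

/-- `Follows d ω h`: on the realization `ω`, the rule `d` leads to the partial schedule `h`, and
`h` is feasible: no job is started twice, and a job is started on a machine only if all jobs
started there before are completed. -/
inductive Follows {I : Input} (d : DecisionRule I) (ω : I.Realization) : Schedule I → Prop where
  | nil : Follows d ω []
  | start {h : Schedule I} {t : ℝ} {J : Fin I.N} {i : Fin I.m}
      (prev : Follows d ω h)
      (time : IsDecisionTime h t)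
      (waits : ∀ s, IsDecisionTime h s → s < t → d h s = none)
      (starts : d h t = some (J, i))
      (fresh : ∀ e ∈ h, e.job ≠ J)
      (free : ∀ e ∈ h, e.machine = i → e.completion ≤ t) :
      Follows d ω (⟨J, i, t, ω J⟩ :: h)

/-- On the realization `ω`, the rule `d` produces the feasible schedule `h` of all jobs. -/
def Produces {I : Input} (d : DecisionRule I) (ω : I.Realization) (h : Schedule I) : Prop :=
  Follows d ω h ∧ ∀ J, ∃ e ∈ h, e.job = J

/-- A non-anticipatory scheduling policy: a non-anticipatory decision rule that produces a feasible
schedule of all jobs on every realization (of positive probability). -/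
structure Policy (I : Input) where
  decide : DecisionRule I
  schedules : ∀ ω : I.Realization, 0 < I.prob ω → ∃ h, Produces decide ω h

/-- `P.HasSchedule ω h`: the realization `ω` has positive probability, and `h` is the schedule
that the policy produces on it. -/
def Policy.HasSchedule {I : Input} (P : Policy I) (ω : I.Realization) (h : Schedule I) : Prop :=
  0 < I.prob ω ∧ Produces P.decide ω h

/-- No machine is idle at a time at which not all jobs have been started. -/
def Policy.NonIdling {I : Input} (P : Policy I) : Prop :=
  ∀ ω h, P.HasSchedule ω h → ∀ (i : Fin I.m) (t : ℝ), 0 ≤ t →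
    (∀ e ∈ h, e.machine = i → ¬ (e.start ≤ t ∧ t < e.completion)) →
    ∀ e ∈ h, e.start ≤ t

/-- Jobs of the same type are started in order of index (schedules list later starts first). -/
def Policy.StartsInIndexOrder {I : Input} (P : Policy I) : Prop :=
  ∀ ω h, P.HasSchedule ω h →
    h.Pairwise fun later earlier =>
      I.type later.job = I.type earlier.job → earlier.job < later.job

/-- Stratified policies with respect to the sets of time points `Q` and the threshold time
points `thr`. The infimum in `rest` is the next time point from `Q j` that is neither before
`thr j` nor before the completion of the long job `e`. -/
structure Policy.IsStratified {I : Input} (P : Policy I) (Q : JobType → Set ℝ)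
    (thr : JobType → ℝ) : Prop where
  aligned : ∀ ω h, P.HasSchedule ω h → ∀ e ∈ h, e.start ∈ Q (I.type e.job)
  rest : ∀ ω h, P.HasSchedule ω h → ∀ e ∈ h, e.long = true →
    ∀ e₂ ∈ h, e₂.machine = e.machine →
      ¬ (e.completion ≤ e₂.start ∧
        e₂.start < sInf {t | t ∈ Q (I.type e.job) ∧ max (thr (I.type e.job)) e.completion ≤ t})
  ordered : P.StartsInIndexOrder

/-- The time points `l₀ = 0` and `lₖ₊₁ = p₁ + k ε p₁`. -/
noncomputable def gridPoint (ε p₁ : ℝ) : ℕ → ℝ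
  | 0 => 0
  | k + 1 => p₁ + k * (ε * p₁)

/-- The stretched time points `(1 + 5ε) lₖ`. -/
noncomputable def stretchedPoint (ε p₁ : ℝ) (k : ℕ) : ℝ :=
  (1 + 5 * ε) * gridPoint ε p₁ k

/-- The multiples of `ε p₂` to the right of the `k`-th stretched point from which a job of size
`p₂` completes no later than the next stretched point. -/
def typeTwoBlock (ε p₁ p₂ : ℝ) (k : ℕ) : Set ℝ :=
  {t | ∃ i : ℕ, t = stretchedPoint ε p₁ k + i * (ε * p₂) ∧ t ≤ stretchedPoint ε p₁ (k + 1) - p₂}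

/-- The sets `Q₁` and `Q₂` of allowed start times for jobs of the two types. -/
def startPoints (ε p₁ p₂ : ℝ) : JobType → Set ℝ
  | .one => typeTwoBlock ε p₁ p₂ 0 ∪ {t | ∃ k : ℕ, 1 ≤ k ∧ t = stretchedPoint ε p₁ k}
  | .two => ⋃ k : ℕ, typeTwoBlock ε p₁ p₂ k

end TwoTypeScheduling

namespace TwoTypeScheduling

/-! The new policy simulates `P` with delay. Jobs that `P` starts before `p₁` keep time and machine:
non-idling forces these times to be multiples of `p₂` (`exists_multiple`), hence grid points. A
type-one job that `P` starts in the interval `[l_{c+1}, l_{c+2})` moves to the stretched point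
`l'_{c+2}` on its own machine. Late type-two jobs give up their machines: in index order they fill
slots of length `p₂` in the stretched intervals `[l'_{j+1}, l'_{j+2}]`, on the machines that no long
type-one job of `P` blocks throughout `[l_{j+1}, l_{j+2})`. The slot number is the number of earlier
late long type-two jobs, so a short job shares its slot with the next long one.

Capacity: a machine on which `P` starts a job in an interval is available there, and by `p₂ ≤ ε² p₁`
stretching adds more slots than the roundings cost. Hence a type-two job of interval `c` finds a
slot in a block no later than `c` (`card_precedingLong_lt`) and starts before `l'_{c+2}`, as does
everything up to that point for type one. This gives the factor `(1 + ε)(1 + 5ε)`, below the claimed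
one.

Feasibility: the stretch creates enough room for postponed type-one jobs exactly when `ε (3 - 10ε) ≥
0` (`stretchedPoint_add_le`). `exists_rest_point` combines this with the slot structure.

Non-anticipation (`next_start_eq`): let `u` be the first job in the order of `P` not yet started by
the new schedule. All that `P` did before `u` is known. The next new start is `u` itself or the next
type-two job in index order, and the latter lies in a block whose available machines are determined
before `P` starts `u`. -/

/-! ### Runs of a decision rule: determinism and shared prefixes. -/

/-- The processing time of a job on a realization. -/
noncomputable def Input.duration (I : Input) (ω : I.Realization) (J : Fin I.N) : ℝ :=
  if ω J then I.size (I.type J) else 0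

theorem StartedJob.ext_of {I : Input} {e f : StartedJob I} (hj : e.job = f.job)
    (hm : e.machine = f.machine) (hs : e.start = f.start) (hl : e.long = f.long) : e = f := by
  cases e; cases f; simp_all

/-- The relation between a later and an earlier entry of a feasible schedule. -/
def Compatible {I : Input} (later earlier : StartedJob I) : Prop :=
  earlier.start ≤ later.start ∧ earlier.job ≠ later.job ∧
    (earlier.machine = later.machine → earlier.completion ≤ later.start)

theorem Follows.pairwise {I : Input} {d : DecisionRule I} {ω : I.Realization} {h : Schedule I}
    (H : Follows d ω h) : h.Pairwise Compatible := by
  induction H with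
  | nil => exact List.Pairwise.nil
  | start prev time waits starts fresh free ih =>
    exact List.pairwise_cons.2 ⟨fun e he => ⟨time.2 e he, fresh e he, free e he⟩, ih⟩

theorem Follows.long_eq {I : Input} {d : DecisionRule I} {ω : I.Realization} {h : Schedule I}
    (H : Follows d ω h) : ∀ e ∈ h, e.long = ω e.job := by
  induction H with
  | nil => simp
  | start prev time waits starts fresh free ih =>
    intro e he
    rcases List.mem_cons.1 he with rfl | he
    · rfl
    · exact ih e he

theorem Follows.start_nonneg {I : Input} {d : DecisionRule I} {ω : I.Realization} {h : Schedule I}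
    (H : Follows d ω h) : ∀ e ∈ h, 0 ≤ e.start := by
  induction H with
  | nil => simp
  | start prev time waits starts fresh free ih =>
    intro e he
    rcases List.mem_cons.1 he with rfl | he
    · exact time.1
    · exact ih e he

theorem Follows.suffix {I : Input} {d : DecisionRule I} {ω : I.Realization} {h h' : Schedule I}
    (H : Follows d ω h) (hs : h' <:+ h) : Follows d ω h' := by
  induction H with
  | nil => rw [List.suffix_nil.1 hs]; exact Follows.nil
  | start prev time waits starts fresh free ih =>
    rcases List.suffix_cons_iff.1 hs with rfl | hs
    · exact Follows.start prev time waits starts fresh free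
    · exact ih hs

/-- Two runs of a rule that share a partial schedule continue with the same action. -/
theorem Follows.next_eq {I : Input} {d : DecisionRule I} {ω ω' : I.Realization} {h : Schedule I}
    {e e' : StartedJob I} (H : Follows d ω (e :: h)) (H' : Follows d ω' (e' :: h)) :
    e'.job = e.job ∧ e'.machine = e.machine ∧ e'.start = e.start := by
  cases H with
  | start prev time waits starts fresh free =>
    cases H' with
    | start prev' time' waits' starts' fresh' free' =>
      rename_i t J i t' J' i'
      have ht : t' = t := by
        rcases lt_trichotomy t' t with h1 | h1 | h1
        · rw [waits _ time' h1] at starts'; cases starts'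
        · exact h1
        · rw [waits' _ time h1] at starts; cases starts
      subst ht
      rw [starts] at starts'
      cases starts'
      exact ⟨rfl, rfl, rfl⟩

theorem exists_cons_suffix {α : Type*} {h S : List α} (hs : h <:+ S) (hne : h ≠ S) :
    ∃ e, (e :: h) <:+ S := by
  obtain ⟨l, rfl⟩ := hs
  rcases List.eq_nil_or_concat l with rfl | ⟨l', a, rfl⟩
  · simp at hne
  · exact ⟨a, l', by simp⟩

theorem exists_cons_suffix_of_mem {α : Type*} {e : α} {S : List α} (he : e ∈ S) :
    ∃ h, (e :: h) <:+ S := by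
  obtain ⟨a, b, rfl⟩ := List.append_of_mem he
  exact ⟨b, a, rfl⟩

/-- Suffixes of one list are nested, and no job occurs twice; so a job determines its entry and the
history at its start. -/
theorem cons_suffix_unique {I : Input} {S : Schedule I} (hS : S.Pairwise Compatible)
    {e e' : StartedJob I} {h h' : Schedule I} (H : (e :: h) <:+ S) (H' : (e' :: h') <:+ S)
    (hj : e.job = e'.job) : e = e' ∧ h = h' := by
  have key : ∀ {e e' : StartedJob I} {h h' : Schedule I}, (e :: h) <:+ S → (e' :: h') <:+ S →
      e.job = e'.job → h.length ≤ h'.length → e = e' ∧ h = h' := by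
    intro e e' h h' H H' hj hl
    have := List.suffix_of_suffix_length_le H H' (by simpa using hl)
    rcases List.suffix_cons_iff.1 this with h1 | h1
    · simpa using h1
    · have h2 := (List.pairwise_cons.1 (hS.sublist H'.sublist)).1 e (h1.subset (by simp))
      exact absurd hj h2.2.1
  rcases le_total h.length h'.length with hl | hl
  · exact key H H' hj hl
  · obtain ⟨a, b⟩ := key H' H hj.symm hl
    exact ⟨a.symm, b.symm⟩

/-- Two realizations that agree on the jobs of a partial schedule share it. -/
theorem Produces.suffix_of_agree {I : Input} {d : DecisionRule I} {ω ω' : I.Realization}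
    {S S' : Schedule I} (H : Produces d ω S) (H' : Produces d ω' S') :
    ∀ h : Schedule I, h <:+ S → (∀ e ∈ h, ω e.job = ω' e.job) → h <:+ S'
  | [], _, _ => List.nil_suffix
  | e :: h, hs, hag => by
    have hs0 : h <:+ S := (List.suffix_cons e h).trans hs
    have ih := suffix_of_agree H H' h hs0 fun f hf => hag f (List.mem_cons_of_mem _ hf)
    have hne : h ≠ S' := by
      rintro rfl
      obtain ⟨f, hf, hfe⟩ := H'.2 e.job
      exact ((List.pairwise_cons.1 (H.1.pairwise.sublist hs.sublist)).1 f hf).2.1 hfe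
    obtain ⟨e', he'⟩ := exists_cons_suffix ih hne
    have hF := H.1.suffix hs
    have hF' := H'.1.suffix he'
    obtain ⟨h1, h2, h3⟩ := hF.next_eq hF'
    have : e' = e := StartedJob.ext_of h1 h2 h3 (by
      rw [hF.long_eq e (by simp), hF'.long_eq e' (by simp), h1, hag e (by simp)])
    rwa [this] at he'

theorem Produces.unique {I : Input} {d : DecisionRule I} {ω : I.Realization} {S S' : Schedule I}
    (H : Produces d ω S) (H' : Produces d ω S') : S = S' := by
  have h1 := H.suffix_of_agree H' S List.suffix_rfl fun _ _ => rfl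
  have h2 := H'.suffix_of_agree H S' List.suffix_rfl fun _ _ => rfl
  exact h1.eq_of_length (le_antisymm h1.length_le h2.length_le)

/-! ### Timetables: schedules as functions of the job. -/

/-- A schedule of all jobs, given by start times, machines and positions in the order of starts. -/
structure Timetable (I : Input) where
  start : Fin I.N → ℝ
  machine : Fin I.N → Fin I.m
  pos : Fin I.N → ℕ

/-- The timetable comes from a feasible non-idling schedule that respects the index order. -/
structure Timetable.IsValid {I : Input} (X : Timetable I) (ω : I.Realization) : Prop where
  pos_injective : Function.Injective X.pos
  start_nonneg : ∀ J, 0 ≤ X.start J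
  start_le : ∀ J K, X.pos J < X.pos K → X.start J ≤ X.start K
  free : ∀ J K, X.pos J < X.pos K → X.machine J = X.machine K →
    X.start J + I.duration ω J ≤ X.start K
  ordered : ∀ J K, I.type J = I.type K → X.pos J < X.pos K → J < K
  nonIdling : ∀ (i : Fin I.m) (t : ℝ), 0 ≤ t →
    (∀ J, X.machine J = i → ¬ (X.start J ≤ t ∧ t < X.start J + I.duration ω J)) →
    ∀ J, X.start J ≤ t

/-- The position of a job is the length of the history at its start. The second conjunct is
non-anticipation: a job's data depend only on the outcomes of the jobs before it. -/
theorem Policy.exists_timetable {I : Input} (P : Policy I) (hP_nonIdling : P.NonIdling)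
    (hP_order : P.StartsInIndexOrder) :
    ∃ X : I.Realization → Timetable I, (∀ ω, 0 < I.prob ω → (X ω).IsValid ω) ∧
      (∀ ω ω', 0 < I.prob ω → 0 < I.prob ω' → ∀ J,
        (∀ K, (X ω).pos K < (X ω).pos J → ω K = ω' K) →
        (X ω').start J = (X ω).start J ∧ (X ω').machine J = (X ω).machine J ∧
          (X ω').pos J = (X ω).pos J) ∧
      ∀ ω S, P.HasSchedule ω S → ∀ e ∈ S, e.start = (X ω).start e.job := by
  classical
  have hex : ∀ ω, ∃ X : Timetable I, ∃ S, 0 < I.prob ω → P.HasSchedule ω S ∧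
      ∃ H : Fin I.N → Schedule I, ∀ J,
        ((⟨J, X.machine J, X.start J, ω J⟩ : StartedJob I) :: H J) <:+ S ∧
          (H J).length = X.pos J := by
    intro ω
    by_cases hω : 0 < I.prob ω
    · obtain ⟨S, hS⟩ := P.schedules ω hω
      choose e he hej using hS.2
      choose H hH using fun J => exists_cons_suffix_of_mem (he J)
      refine ⟨⟨fun J => (e J).start, fun J => (e J).machine, fun J => (H J).length⟩, S,
        fun _ => ⟨⟨hω, hS⟩, H, fun J => ⟨?_, rfl⟩⟩⟩
      convert hH J using 2
      refine StartedJob.ext_of (hej J).symm rfl rfl ?_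
      rw [hS.1.long_eq _ (he J), hej J]
    -- A null realization needs only a dummy timetable, but that requires machines to exist if there
    -- are jobs. The all-long realization has positive probability and supplies them.
    · obtain ⟨S, hS⟩ := P.schedules (fun _ => true) (by
        unfold Input.prob
        exact Finset.prod_pos fun J _ => by simpa using I.q_pos J)
      choose e he hej using hS.2
      exact ⟨⟨fun J => (e J).start, fun J => (e J).machine, fun _ => 0⟩, [], fun h => absurd h hω⟩
  choose X S hX using hex
  choose hS H hH using hX
  have hpw : ∀ ω (hω : 0 < I.prob ω), (S ω).Pairwise Compatible :=
    fun ω hω => (hS ω hω).2.1.pairwise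
  have mem_of_lt : ∀ ω (hω : 0 < I.prob ω) J K, (X ω).pos J < (X ω).pos K →
      (⟨J, (X ω).machine J, (X ω).start J, ω J⟩ : StartedJob I) ∈ H ω hω K := by
    intro ω hω J K hJK
    have h1 := List.suffix_of_suffix_length_le (hH ω hω J).1 (hH ω hω K).1 (by
      simp only [List.length_cons, (hH ω hω J).2, (hH ω hω K).2]; omega)
    rcases List.suffix_cons_iff.1 h1 with h2 | h2
    · have := congrArg List.length h2
      simp only [List.length_cons, (hH ω hω J).2, (hH ω hω K).2] at this
      omega
    · exact h2.subset (by simp)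
  have rel_of_lt : ∀ ω (hω : 0 < I.prob ω) (R : StartedJob I → StartedJob I → Prop),
      (S ω).Pairwise R → ∀ J K, (X ω).pos J < (X ω).pos K →
      R ⟨K, (X ω).machine K, (X ω).start K, ω K⟩ ⟨J, (X ω).machine J, (X ω).start J, ω J⟩ := by
    intro ω hω R hR J K hJK
    exact (List.pairwise_cons.1 (hR.sublist (hH ω hω K).1.sublist)).1 _ (mem_of_lt ω hω J K hJK)
  have mem_entry : ∀ ω (hω : 0 < I.prob ω), ∀ e ∈ S ω,
      e = ⟨e.job, (X ω).machine e.job, (X ω).start e.job, ω e.job⟩ := by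
    intro ω hω e he
    obtain ⟨h, hh⟩ := exists_cons_suffix_of_mem he
    exact (cons_suffix_unique (hpw ω hω) hh (hH ω hω e.job).1 rfl).1
  refine ⟨X, fun ω hω => ⟨?_, ?_, ?_, ?_, ?_, ?_⟩, ?_, ?_⟩
  · intro J K hJK
    have h1 := List.suffix_of_suffix_length_le (hH ω hω J).1 (hH ω hω K).1 (by
      simp only [List.length_cons, (hH ω hω J).2, (hH ω hω K).2, hJK, le_refl])
    have h2 := h1.eq_of_length (by
      simp only [List.length_cons, (hH ω hω J).2, (hH ω hω K).2, hJK])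
    simp only [List.cons.injEq, StartedJob.mk.injEq] at h2
    exact h2.1.1
  · intro J
    exact (hS ω hω).2.1.start_nonneg _ ((hH ω hω J).1.subset List.mem_cons_self)
  · intro J K hJK
    exact (rel_of_lt ω hω _ (hpw ω hω) J K hJK).1
  · intro J K hJK hm
    exact (rel_of_lt ω hω _ (hpw ω hω) J K hJK).2.2 hm
  · intro J K ht hJK
    exact rel_of_lt ω hω _ (hP_order ω _ (hS ω hω)) J K hJK ht.symm
  · intro i t ht hidle J
    refine hP_nonIdling ω _ (hS ω hω) i t ht ?_ _ ((hH ω hω J).1.subset List.mem_cons_self)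
    intro e he hm
    have h1 := mem_entry ω hω e he
    rw [h1] at hm ⊢
    exact hidle e.job hm
  · intro ω ω' hω hω' J hag
    have hag' : ∀ e ∈ H ω hω J, ω e.job = ω' e.job := by
      intro e he
      apply hag
      have h1 : e ∈ S ω := (hH ω hω J).1.subset (List.mem_cons_of_mem _ he)
      obtain ⟨a, b, hab⟩ := List.append_of_mem he
      have h2 : (e :: b) <:+ S ω :=
        (List.IsSuffix.trans ⟨a, hab.symm⟩ (List.suffix_cons _ _)).trans (hH ω hω J).1
      have h3 := (cons_suffix_unique (hpw ω hω) h2 (hH ω hω e.job).1 rfl).2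
      rw [← (hH ω hω e.job).2, ← (hH ω hω J).2, ← h3, hab]
      simp only [List.length_append, List.length_cons]
      omega
    have hs := (hS ω hω).2.suffix_of_agree (hS ω' hω').2 _
      ((List.suffix_cons _ _).trans (hH ω hω J).1) hag'
    have hne : H ω hω J ≠ S ω' := by
      intro heq
      obtain ⟨f, hf, hfJ⟩ := (hS ω' hω').2.2 J
      rw [← heq] at hf
      exact ((List.pairwise_cons.1 ((hpw ω hω).sublist (hH ω hω J).1.sublist)).1 f hf).2.1 hfJ
    obtain ⟨e', he'⟩ := exists_cons_suffix hs hne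
    obtain ⟨h1, h2, h3⟩ :=
      ((hS ω hω).2.1.suffix (hH ω hω J).1).next_eq ((hS ω' hω').2.1.suffix he')
    obtain ⟨h4, h5⟩ := cons_suffix_unique (hpw ω' hω') he' (hH ω' hω' J).1 h1
    subst h4
    exact ⟨h3, h2, by rw [← (hH ω hω J).2, ← (hH ω' hω' J).2, ← h5]⟩
  · intro ω S' hS' e he
    have hω := hS'.1
    rw [hS'.2.unique (hS ω hω).2] at he
    have h1 := mem_entry ω hω e he
    exact congrArg StartedJob.start h1

/-! ### Turning a non-anticipatory family of schedules into a policy. -/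

open Classical in
/-- The rule that replays a family of schedules. -/
noncomputable def replayRule {I : Input} (T : I.Realization → Schedule I) : DecisionRule I :=
  fun h t =>
    if H : ∃ e : StartedJob I, e.start = t ∧ ∃ ω, 0 < I.prob ω ∧ (e :: h) <:+ T ω then
      some (H.choose.job, H.choose.machine)
    else none

/-- A non-anticipatory family of feasible schedules of all jobs is produced by a policy. -/
theorem exists_policy_of_schedules {I : Input} (T : I.Realization → Schedule I)
    (hall : ∀ ω, 0 < I.prob ω → ∀ J, ∃ e ∈ T ω, e.job = J)
    (hlong : ∀ ω, 0 < I.prob ω → ∀ e ∈ T ω, e.long = ω e.job)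
    (hnonneg : ∀ ω, 0 < I.prob ω → ∀ e ∈ T ω, 0 ≤ e.start)
    (hpair : ∀ ω, 0 < I.prob ω → (T ω).Pairwise Compatible)
    (hna : ∀ ω ω', 0 < I.prob ω → 0 < I.prob ω' → ∀ h e e', (e :: h) <:+ T ω →
      (e' :: h) <:+ T ω' → e'.job = e.job ∧ e'.machine = e.machine ∧ e'.start = e.start) :
    ∃ R : Policy I, ∀ ω S, R.HasSchedule ω S → S = T ω := by
  -- The rule picks an arbitrary extension of `h`; by `hna` all extensions have the same job,
  -- machine and time.
  have hrule : ∀ ω, 0 < I.prob ω → ∀ h e, (e :: h) <:+ T ω → ∀ t,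
      (t = e.start → replayRule T h t = some (e.job, e.machine)) ∧
      (t ≠ e.start → replayRule T h t = none) := by
    intro ω hω h e he t
    refine ⟨fun ht => ?_, fun ht => ?_⟩
    · have H : ∃ e : StartedJob I, e.start = t ∧ ∃ ω, 0 < I.prob ω ∧ (e :: h) <:+ T ω :=
        ⟨e, ht.symm, ω, hω, he⟩
      rw [replayRule, dif_pos H]
      obtain ⟨-, ω', hω', h1⟩ := H.choose_spec
      obtain ⟨h2, h3, -⟩ := hna ω ω' hω hω' h e _ he h1
      rw [h2, h3]
    · rw [replayRule, dif_neg]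
      rintro ⟨e', h1, ω', hω', h2⟩
      exact ht (h1 ▸ (hna ω ω' hω hω' h e e' he h2).2.2)
  have hfol : ∀ ω, 0 < I.prob ω → ∀ h, h <:+ T ω → Follows (replayRule T) ω h := by
    intro ω hω h
    induction h with
    | nil => exact fun _ => Follows.nil
    | cons e h ih =>
      intro hs
      have hp := List.pairwise_cons.1 ((hpair ω hω).sublist hs.sublist)
      have hmem : e ∈ T ω := hs.subset (by simp)
      have hF := Follows.start (J := e.job) (i := e.machine) (t := e.start)
        (ih ((List.suffix_cons e h).trans hs))
        ⟨hnonneg ω hω e hmem, fun f hf => (hp.1 f hf).1⟩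
        (fun s _ hlt => (hrule ω hω h e hs s).2 hlt.ne) ((hrule ω hω h e hs e.start).1 rfl)
        (fun f hf => (hp.1 f hf).2.1) (fun f hf => (hp.1 f hf).2.2)
      rw [← hlong ω hω e hmem] at hF
      exact hF
  have hprod : ∀ ω, 0 < I.prob ω → Produces (replayRule T) ω (T ω) :=
    fun ω hω => ⟨hfol ω hω _ List.suffix_rfl, hall ω hω⟩
  exact ⟨⟨replayRule T, fun ω hω => ⟨_, hprod ω hω⟩⟩,
    fun ω S hS => hS.2.unique (hprod ω hS.1)⟩

/-! ### Enumeration of slots: by block, then round, then member. -/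

/-- The number of slots in the first `k` blocks, if block `j` consists of `M` rounds with one slot
for each member of `F j`. -/
def slotCount {α : Type*} (F : ℕ → Finset α) (M k : ℕ) : ℕ :=
  ∑ j ∈ Finset.range k, (F j).card * M

/-- The block of the `c`-th slot. -/
noncomputable def slotBlock {α : Type*} (F : ℕ → Finset α) (M c : ℕ) : ℕ :=
  sInf {k | c < slotCount F M (k + 1)}

/-- The position of the `c`-th slot within its block. -/
noncomputable def slotOffset {α : Type*} (F : ℕ → Finset α) (M c : ℕ) : ℕ :=
  c - slotCount F M (slotBlock F M c)

/-- The round of the `c`-th slot within its block. -/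
noncomputable def slotRound {α : Type*} (F : ℕ → Finset α) (M c : ℕ) : ℕ :=
  slotOffset F M c / (F (slotBlock F M c)).card

/-- The member to which the `c`-th slot belongs (`d` if there is no such slot). -/
noncomputable def slotMember {α : Type*} (F : ℕ → Finset α) (M c : ℕ) (d : α) : α :=
  (F (slotBlock F M c)).toList.getD (slotOffset F M c % (F (slotBlock F M c)).card) d

section Slots

variable {α : Type*} {F G : ℕ → Finset α} {M c c' K : ℕ}

theorem slotCount_succ (F : ℕ → Finset α) (M k : ℕ) :
    slotCount F M (k + 1) = slotCount F M k + (F k).card * M :=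
  Finset.sum_range_succ _ _

theorem slotCount_congr (k : ℕ) (h : ∀ j < k, F j = G j) : slotCount F M k = slotCount G M k :=
  Finset.sum_congr rfl fun j hj => by rw [h j (Finset.mem_range.1 hj)]

theorem slotBlock_lt (h : c < slotCount F M K) : slotBlock F M c < K := by
  cases K with
  | zero => simp [slotCount] at h
  | succ k => exact Nat.lt_succ_of_le (Nat.sInf_le h)

theorem lt_slotCount_slotBlock (h : c < slotCount F M K) :
    c < slotCount F M (slotBlock F M c + 1) := by
  cases K with
  | zero => simp [slotCount] at h
  | succ k => exact Nat.sInf_mem (s := {k | c < slotCount F M (k + 1)}) ⟨k, h⟩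

theorem slotCount_slotBlock_le (F : ℕ → Finset α) (M c : ℕ) :
    slotCount F M (slotBlock F M c) ≤ c := by
  by_contra! h
  exact lt_irrefl _ (slotBlock_lt h)

theorem slotOffset_lt (h : c < slotCount F M K) :
    slotOffset F M c < (F (slotBlock F M c)).card * M := by
  have h1 := lt_slotCount_slotBlock h
  have h2 := slotCount_slotBlock_le F M c
  rw [slotCount_succ] at h1
  unfold slotOffset
  omega

theorem card_slotBlock_pos (h : c < slotCount F M K) : 0 < (F (slotBlock F M c)).card := by
  have := slotOffset_lt h
  by_contra! h0
  simp [Nat.le_zero.1 h0] at this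

theorem slotRound_lt (h : c < slotCount F M K) : slotRound F M c < M :=
  Nat.div_lt_of_lt_mul (slotOffset_lt h)

theorem slotMember_mem (h : c < slotCount F M K) (d : α) :
    slotMember F M c d ∈ F (slotBlock F M c) := by
  have h1 := Nat.mod_lt (slotOffset F M c) (card_slotBlock_pos h)
  rw [slotMember, List.getD_eq_getElem _ _ (by simpa using h1), ← Finset.mem_toList]
  exact List.getElem_mem _

theorem slotBlock_mono (hc : c ≤ c') (h : c' < slotCount F M K) :
    slotBlock F M c ≤ slotBlock F M c' :=
  Nat.lt_succ_iff.1 (slotBlock_lt (hc.trans_lt (lt_slotCount_slotBlock h)))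

theorem slotRound_mono (hc : c ≤ c') (hb : slotBlock F M c = slotBlock F M c') :
    slotRound F M c ≤ slotRound F M c' := by
  unfold slotRound slotOffset
  rw [hb]
  exact Nat.div_le_div_right (by omega)

/-- Round and member are quotient and remainder of the offset by the block's cardinality, so
equality of both would force equal slots. -/
theorem slotRound_strictMono (hc : c < c') (h : c' < slotCount F M K)
    (hb : slotBlock F M c = slotBlock F M c') {d d' : α}
    (hm : slotMember F M c d = slotMember F M c' d') : slotRound F M c < slotRound F M c' := by
  refine lt_of_le_of_ne (slotRound_mono hc.le hb) fun heq => ?_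
  have h0 : c < slotCount F M K := hc.trans h
  have hlt := Nat.mod_lt (slotOffset F M c) (card_slotBlock_pos h0)
  have hlt' := Nat.mod_lt (slotOffset F M c') (card_slotBlock_pos h)
  rw [slotMember, slotMember, List.getD_eq_getElem _ _ (by simpa using hlt),
    List.getD_eq_getElem _ _ (by simpa using hlt')] at hm
  have hoff : slotOffset F M c < slotOffset F M c' := by
    have := slotCount_slotBlock_le F M c
    unfold slotOffset
    rw [← hb]
    omega
  unfold slotRound at heq
  simp only [← hb] at hm heq
  have hmod := (Finset.nodup_toList _).getElem_inj_iff.1 hm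
  have e1 := Nat.div_add_mod (slotOffset F M c) (F (slotBlock F M c)).card
  have e2 := Nat.div_add_mod (slotOffset F M c') (F (slotBlock F M c)).card
  rw [heq, hmod] at e1
  omega

/-- Agreement is required only up to the block of `c`: later availability must not influence a slot,
since it is not yet known when the slot is used. -/
theorem slotBlock_congr (h : c < slotCount F M K) (hFG : ∀ j ≤ slotBlock F M c, F j = G j) :
    slotBlock G M c = slotBlock F M c := by
  have h1 := lt_slotCount_slotBlock h
  rw [slotCount_congr (G := G) _ fun j hj => hFG j (Nat.lt_succ_iff.1 hj)] at h1
  have hle := Nat.lt_succ_iff.1 (slotBlock_lt h1)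
  refine le_antisymm hle ?_
  have h2 := lt_slotCount_slotBlock h1
  rw [← slotCount_congr (F := F) _ fun j hj => hFG j ((Nat.lt_succ_iff.1 hj).trans hle)] at h2
  exact Nat.lt_succ_iff.1 (slotBlock_lt h2)

theorem slotOffset_congr (h : c < slotCount F M K) (hFG : ∀ j ≤ slotBlock F M c, F j = G j) :
    slotOffset G M c = slotOffset F M c := by
  rw [slotOffset, slotOffset, slotBlock_congr h hFG,
    slotCount_congr (F := F) (G := G) _ fun j hj => hFG j hj.le]

theorem slotRound_congr (h : c < slotCount F M K) (hFG : ∀ j ≤ slotBlock F M c, F j = G j) :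
    slotRound G M c = slotRound F M c := by
  rw [slotRound, slotRound, slotOffset_congr h hFG, slotBlock_congr h hFG, hFG _ le_rfl]

theorem slotMember_congr (h : c < slotCount F M K) (hFG : ∀ j ≤ slotBlock F M c, F j = G j)
    (d d' : α) : slotMember G M c d' = slotMember F M c d := by
  have h1 := Nat.mod_lt (slotOffset F M c) (card_slotBlock_pos h)
  rw [slotMember, slotMember, slotOffset_congr h hFG, slotBlock_congr h hFG, ← hFG _ le_rfl,
    List.getD_eq_getElem _ _ (by simpa using h1), List.getD_eq_getElem _ _ (by simpa using h1)]

end Slots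

/-! ### Construction of the stratified schedule. -/

/-- The assumptions on the accuracy and the separation of the two job sizes. -/
structure Separated (ε : ℝ) (I : Input) : Prop where
  pos : 0 < ε
  le : ε ≤ 3 / 10
  int : ∃ k : ℕ, 1 / ε = k
  sep : I.p₂ ≤ ε ^ 2 * I.p₁

theorem Input.p₁_pos (I : Input) : 0 < I.p₁ := I.p₂_pos.trans I.p₂_lt_p₁

/-- The index of the interval of the (unstretched) grid that contains `s ≥ p₁`. -/
noncomputable def cell (ε p₁ s : ℝ) : ℕ := ⌊(s - p₁) / (ε * p₁)⌋₊

/-- The number of jobs of size `p₂` that fit into a stretched interval. -/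
noncomputable def rounds (ε : ℝ) (I : Input) : ℕ := ⌊(1 + 5 * ε) * (ε * I.p₁) / I.p₂⌋₊

open Classical in
/-- The machines that are not occupied by a job of type one throughout the `j`-th interval. -/
noncomputable def available (ε : ℝ) {I : Input} (ω : I.Realization) (X : Timetable I) (j : ℕ) :
    Finset (Fin I.m) :=
  Finset.univ.filter fun i => ∀ J, I.type J = .one → ω J = true → X.machine J = i →
    X.start J < gridPoint ε I.p₁ (j + 1) → X.start J + I.p₁ < gridPoint ε I.p₁ (j + 2)

open Classical in
/-- The long jobs of type two that precede `J` and start no earlier than `p₁`. -/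
noncomputable def precedingLong {I : Input} (ω : I.Realization) (X : Timetable I) (J : Fin I.N) :
    Finset (Fin I.N) :=
  Finset.univ.filter fun K => K < J ∧ I.type K = .two ∧ ω K = true ∧ I.p₁ ≤ X.start K

/-- The start times of the stratified schedule. Jobs that start before `p₁` keep their start times,
later jobs of type one are postponed to the end of the stretched interval, and later jobs of type
two are started one after the other in the slots provided by the available machines. -/
noncomputable def newStart (ε : ℝ) {I : Input} (ω : I.Realization) (X : Timetable I)
    (J : Fin I.N) : ℝ :=
  if X.start J < I.p₁ then X.start J else
    match I.type J with
    | .one => stretchedPoint ε I.p₁ (cell ε I.p₁ (X.start J) + 2)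
    | .two =>
      stretchedPoint ε I.p₁
        (slotBlock (available ε ω X) (rounds ε I) (precedingLong ω X J).card + 1) +
      slotRound (available ε ω X) (rounds ε I) (precedingLong ω X J).card * I.p₂

/-- The machines of the stratified schedule. -/
noncomputable def newMachine (ε : ℝ) {I : Input} (ω : I.Realization) (X : Timetable I)
    (J : Fin I.N) : Fin I.m :=
  if X.start J < I.p₁ then X.machine J else
    match I.type J with
    | .one => X.machine J
    | .two =>
      slotMember (available ε ω X) (rounds ε I) (precedingLong ω X J).card (X.machine J)

/-- The order of starts in the stratified schedule. -/
def Before (ε : ℝ) {I : Input} (ω : I.Realization) (X : Timetable I) (J K : Fin I.N) : Prop :=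
  newStart ε ω X J < newStart ε ω X K ∨
    newStart ε ω X J = newStart ε ω X K ∧ X.pos J < X.pos K

/-! ### Arithmetic of the grid and its stretching. -/

section Grid

variable {ε : ℝ} {I : Input}

theorem gridPoint_succ (ε p₁ : ℝ) (j : ℕ) : gridPoint ε p₁ (j + 1) = p₁ + j * (ε * p₁) := rfl

theorem stretchedPoint_succ (ε p₁ : ℝ) (j : ℕ) :
    stretchedPoint ε p₁ (j + 1) = (1 + 5 * ε) * (p₁ + j * (ε * p₁)) := rfl

theorem Separated.step_pos (hS : Separated ε I) : 0 < ε * I.p₁ := mul_pos hS.pos I.p₁_pos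

theorem Separated.factor_pos (hS : Separated ε I) : 0 < 1 + 5 * ε := by linarith [hS.pos]

theorem gridPoint_succ_mono (hS : Separated ε I) {i j : ℕ} (h : i ≤ j) :
    gridPoint ε I.p₁ (i + 1) ≤ gridPoint ε I.p₁ (j + 1) := by
  have : (i : ℝ) ≤ j := by exact_mod_cast h
  simp only [gridPoint_succ]
  have := mul_le_mul_of_nonneg_right this hS.step_pos.le
  linarith

theorem stretchedPoint_succ_mono (hS : Separated ε I) {i j : ℕ} (h : i ≤ j) :
    stretchedPoint ε I.p₁ (i + 1) ≤ stretchedPoint ε I.p₁ (j + 1) :=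
  mul_le_mul_of_nonneg_left (gridPoint_succ_mono hS h) hS.factor_pos.le

theorem lt_of_stretchedPoint_lt (hS : Separated ε I) {i j : ℕ}
    (h : stretchedPoint ε I.p₁ (i + 1) < stretchedPoint ε I.p₁ (j + 1)) : i < j := by
  by_contra! h'
  exact absurd h (not_lt.2 (stretchedPoint_succ_mono hS h'))

theorem stretchedPoint_add_two (ε p₁ : ℝ) (j : ℕ) :
    stretchedPoint ε p₁ (j + 2) = stretchedPoint ε p₁ (j + 1) + (1 + 5 * ε) * (ε * p₁) := by
  rw [stretchedPoint_succ ε p₁ (j + 1), stretchedPoint_succ]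
  push_cast
  ring

theorem gridPoint_add_two (ε p₁ : ℝ) (j : ℕ) :
    gridPoint ε p₁ (j + 2) = gridPoint ε p₁ (j + 1) + ε * p₁ := by
  rw [gridPoint_succ ε p₁ (j + 1), gridPoint_succ]
  push_cast
  ring

theorem gridPoint_cell_le (hS : Separated ε I) {s : ℝ} (hs : I.p₁ ≤ s) :
    gridPoint ε I.p₁ (cell ε I.p₁ s + 1) ≤ s := by
  have h := Nat.floor_le (div_nonneg (sub_nonneg.2 hs) hS.step_pos.le)
  rw [le_div_iff₀ hS.step_pos] at h
  rw [gridPoint_succ, cell]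
  linarith

theorem lt_gridPoint_cell (hS : Separated ε I) (s : ℝ) :
    s < gridPoint ε I.p₁ (cell ε I.p₁ s + 2) := by
  have h := Nat.lt_floor_add_one ((s - I.p₁) / (ε * I.p₁))
  rw [div_lt_iff₀ hS.step_pos] at h
  rw [gridPoint_succ ε I.p₁ (cell ε I.p₁ s + 1), cell]
  push_cast
  linarith

theorem cell_mono (hS : Separated ε I) {s t : ℝ} (h : s ≤ t) : cell ε I.p₁ s ≤ cell ε I.p₁ t :=
  Nat.floor_mono (div_le_div_of_nonneg_right (by linarith) hS.step_pos.le)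

theorem Separated.five_le (hS : Separated ε I) : 5 * I.p₂ ≤ 5 * ε * (ε * I.p₁) := by
  have := hS.sep
  nlinarith

theorem rounds_mul_le (hS : Separated ε I) :
    rounds ε I * I.p₂ ≤ (1 + 5 * ε) * (ε * I.p₁) := by
  have h := Nat.floor_le (div_nonneg (mul_nonneg hS.factor_pos.le hS.step_pos.le) I.p₂_pos.le)
  rwa [le_div_iff₀ I.p₂_pos] at h

/-- Stretching lengthens an interval by `5 ε² p₁ ≥ 5 p₂`, that is, by five slots, and the floor
costs less than one. -/
theorem lt_rounds (hS : Separated ε I) : ε * I.p₁ / I.p₂ + 4 < rounds ε I := by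
  have h := Nat.lt_floor_add_one ((1 + 5 * ε) * (ε * I.p₁) / I.p₂)
  have h2 : (1 + 5 * ε) * (ε * I.p₁) / I.p₂ = ε * I.p₁ / I.p₂ + 5 * ε * (ε * I.p₁) / I.p₂ := by
    ring
  have h3 : 5 ≤ 5 * ε * (ε * I.p₁) / I.p₂ := by
    rw [le_div_iff₀ I.p₂_pos]; exact hS.five_le
  rw [rounds]
  linarith

/-- Postponed jobs of type one on the same machine do not overlap. -/
theorem stretchedPoint_add_le (hS : Separated ε I) {j k : ℕ}
    (h : gridPoint ε I.p₁ (j + 1) + I.p₁ < gridPoint ε I.p₁ (k + 2)) :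
    stretchedPoint ε I.p₁ (j + 2) + I.p₁ ≤ stretchedPoint ε I.p₁ (k + 1) := by
  rw [gridPoint_add_two] at h
  have h1 := mul_le_mul_of_nonneg_left h.le hS.factor_pos.le
  rw [stretchedPoint_add_two]
  simp only [stretchedPoint]
  -- The margin is `(1 + 5ε)(1 - 2ε) p₁ - p₁ = ε (3 - 10ε) p₁`; the bound `ε ≤ 3/10` makes it
  -- nonnegative.
  have h2 : 0 ≤ I.p₁ * ε * (3 - 10 * ε) :=
    mul_nonneg (mul_nonneg I.p₁_pos.le hS.pos.le) (by linarith [hS.le])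
  nlinarith

theorem p₁_le_stretchedPoint_one (hS : Separated ε I) :
    I.p₁ + 2 * I.p₂ ≤ stretchedPoint ε I.p₁ 1 := by
  rw [stretchedPoint_succ]
  have h1 := hS.five_le
  have h2 : 5 * ε * (ε * I.p₁) ≤ 5 * (ε * I.p₁) := by
    have := hS.step_pos
    have := hS.le
    nlinarith
  have := I.p₂_pos
  push_cast
  linarith

/-- Since `l_{j+1} ≥ p₁`, stretching outweighs one grid step. This serves type-one jobs that keep
their start before `p₁` while the job following them is moved. -/
theorem gridPoint_add_two_le_stretchedPoint (hS : Separated ε I) (j : ℕ) :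
    gridPoint ε I.p₁ (j + 2) ≤ stretchedPoint ε I.p₁ (j + 1) := by
  rw [gridPoint_add_two, stretchedPoint]
  have h : I.p₁ ≤ gridPoint ε I.p₁ (j + 1) := by
    have := gridPoint_succ_mono hS (Nat.zero_le j)
    rw [gridPoint_succ ε I.p₁ 0] at this
    simpa using this
  have := mul_le_mul_of_nonneg_left h hS.pos.le
  have := hS.step_pos
  linarith

end Grid

/-! ### Location and order of the new start times. -/

section Start

variable {ε : ℝ} {I : Input} {ω : I.Realization} {X : Timetable I} {J K : Fin I.N}

theorem newStart_early (h : X.start J < I.p₁) : newStart ε ω X J = X.start J := if_pos h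

theorem newMachine_early (h : X.start J < I.p₁) : newMachine ε ω X J = X.machine J := if_pos h

theorem newStart_one (h : I.p₁ ≤ X.start J) (hJ : I.type J = .one) :
    newStart ε ω X J = stretchedPoint ε I.p₁ (cell ε I.p₁ (X.start J) + 2) := by
  rw [newStart, if_neg h.not_gt, hJ]

theorem newMachine_one (hJ : I.type J = .one) : newMachine ε ω X J = X.machine J := by
  rw [newMachine, hJ, ite_self]

theorem newStart_two (h : I.p₁ ≤ X.start J) (hJ : I.type J = .two) :
    newStart ε ω X J = stretchedPoint ε I.p₁
        (slotBlock (available ε ω X) (rounds ε I) (precedingLong ω X J).card + 1) +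
      slotRound (available ε ω X) (rounds ε I) (precedingLong ω X J).card * I.p₂ := by
  rw [newStart, if_neg h.not_gt, hJ]

theorem newMachine_two (h : I.p₁ ≤ X.start J) (hJ : I.type J = .two) :
    newMachine ε ω X J = slotMember (available ε ω X) (rounds ε I) (precedingLong ω X J).card
      (X.machine J) := by
  rw [newMachine, if_neg h.not_gt, hJ]

theorem Input.size_pos (I : Input) (τ : JobType) : 0 < I.size τ := by
  cases τ
  · exact I.p₁_pos
  · exact I.p₂_pos

theorem Timetable.IsValid.pos_lt_of_start_lt (hX : X.IsValid ω) (h : X.start J < X.start K) :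
    X.pos J < X.pos K := by
  by_contra! h'
  rcases h'.lt_or_eq with h1 | h1
  · exact absurd h (not_lt.2 (hX.start_le _ _ h1))
  · rw [hX.pos_injective h1] at h
    exact lt_irrefl _ h

theorem Timetable.IsValid.pos_lt (hX : X.IsValid ω) (ht : I.type J = I.type K) (h : J < K) :
    X.pos J < X.pos K := by
  by_contra! h'
  rcases h'.lt_or_eq with h1 | h1
  · exact absurd h (hX.ordered _ _ ht.symm h1).not_gt
  · exact h.ne (hX.pos_injective h1).symm

theorem Timetable.IsValid.free_of_start_lt (hX : X.IsValid ω) (h : X.start J < X.start K)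
    (hm : X.machine J = X.machine K) (hJ : ω J = true) :
    X.start J + I.size (I.type J) ≤ X.start K := by
  have := hX.free J K (hX.pos_lt_of_start_lt h) hm
  rwa [Input.duration, if_pos hJ] at this

/-- In a non-idling schedule a machine that starts a job completes a long job at the same time. -/
theorem Timetable.IsValid.exists_predecessor (hX : X.IsValid ω) (h : 0 < X.start J) :
    ∃ K, X.start J = X.start K + I.size (I.type K) := by
  classical
  by_contra! hne
  -- If every long job before `J` on its machine completes strictly earlier, the machine is idle at
  -- the last of these completions, or at time `0`, although `J` is waiting.
  let B := Finset.univ.filter fun K => X.machine K = X.machine J ∧ X.start K < X.start J ∧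
    ω K = true
  have hB : ∀ K ∈ B, X.start K + I.size (I.type K) < X.start J := by
    intro K hK
    simp only [B, Finset.mem_filter, Finset.mem_univ, true_and] at hK
    exact lt_of_le_of_ne (hX.free_of_start_lt hK.2.1 hK.1 hK.2.2) (hne K).symm
  obtain ⟨t, ht0, htJ, htB⟩ : ∃ t, 0 ≤ t ∧ t < X.start J ∧
      ∀ K ∈ B, X.start K + I.size (I.type K) ≤ t := by
    rcases B.eq_empty_or_nonempty with hE | hE
    · exact ⟨0, le_rfl, h, by simp [hE]⟩
    · obtain ⟨K, hK, hmax⟩ := B.exists_max_image (fun K => X.start K + I.size (I.type K)) hE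
      exact ⟨_, add_nonneg (hX.start_nonneg K) (I.size_pos _).le, hB K hK, hmax⟩
  refine absurd (hX.nonIdling (X.machine J) t ht0 ?_ J) htJ.not_ge
  rintro K hm ⟨h1, h2⟩
  rw [Input.duration] at h2
  split_ifs at h2 with hK
  · have := htB K (by simp [B, hm, hK, h1.trans_lt htJ])
    linarith
  · linarith

/-- Follow predecessors back to time `0`: before `p₁` none of them can have type one, so each step
back is exactly `p₂`. -/
theorem Timetable.IsValid.exists_multiple (hX : X.IsValid ω) (h : X.start J < I.p₁) :
    ∃ b : ℕ, X.start J = b * I.p₂ := by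
  have key : ∀ n : ℕ, ∀ J, X.start J < I.p₁ → X.start J < n * I.p₂ →
      ∃ b : ℕ, X.start J = b * I.p₂ := by
    intro n
    induction n with
    | zero =>
      intro J _ h2
      have := hX.start_nonneg J
      simp only [Nat.cast_zero, zero_mul] at h2
      linarith
    | succ n ih =>
      intro J h1 h2
      rcases (hX.start_nonneg J).eq_or_lt with h0 | h0
      · exact ⟨0, by simp [← h0]⟩
      · obtain ⟨K, hK⟩ := hX.exists_predecessor h0
        have hK0 := hX.start_nonneg K
        cases hT : I.type K with
        | one =>
          rw [hT, Input.size] at hK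
          linarith
        | two =>
          rw [hT, Input.size] at hK
          push_cast at h2
          have := I.p₂_pos
          obtain ⟨b, hb⟩ := ih K (by linarith) (by linarith)
          exact ⟨b + 1, by rw [hK, hb]; push_cast; ring⟩
  obtain ⟨n, hn⟩ := exists_nat_gt (X.start J / I.p₂)
  rw [div_lt_iff₀ I.p₂_pos] at hn
  exact key n J h hn

/-- A type-one job started there before the interval must be completed when `J` starts, which is
before the interval ends. -/
theorem machine_mem_available (hS : Separated ε I) (hX : X.IsValid ω) (h : I.p₁ ≤ X.start J) :
    X.machine J ∈ available ε ω X (cell ε I.p₁ (X.start J)) := by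
  simp only [available, Finset.mem_filter, Finset.mem_univ, true_and]
  intro K hK hω hm hlt
  have := hX.free_of_start_lt (hlt.trans_le (gridPoint_cell_le hS h)) hm hω
  rw [hK, Input.size] at this
  exact this.trans_lt (lt_gridPoint_cell hS _)

/-- Map each long job to its interval, its machine and its offset in the interval rounded down to
multiples of `p₂`. This is injective, as long jobs on one machine start at least `p₂` apart. One
round per machine stays free, which later leaves a slot for `J` itself. -/
theorem card_precedingLong_le (hS : Separated ε I) (hX : X.IsValid ω) (hJ : I.type J = .two) :
    (precedingLong ω X J).card ≤ ∑ j ∈ Finset.range (cell ε I.p₁ (X.start J) + 1),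
      (available ε ω X j).card * (rounds ε I - 1) := by
  classical
  let off : Fin I.N → ℕ := fun K =>
    ⌊(X.start K - gridPoint ε I.p₁ (cell ε I.p₁ (X.start K) + 1)) / I.p₂⌋₊
  let f : Fin I.N → (_ : ℕ) × (Fin I.m × ℕ) := fun K =>
    ⟨cell ε I.p₁ (X.start K), X.machine K, off K⟩
  let D : Finset ((_ : ℕ) × (Fin I.m × ℕ)) :=
    (Finset.range (cell ε I.p₁ (X.start J) + 1)).sigma fun j =>
      available ε ω X j ×ˢ Finset.range (rounds ε I - 1)
  have hmem : ∀ K ∈ precedingLong ω X J, f K ∈ D := by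
    intro K hK
    simp only [precedingLong, Finset.mem_filter, Finset.mem_univ, true_and] at hK
    obtain ⟨hlt, hT, hω, hp⟩ := hK
    have hpos := hX.pos_lt (hT.trans hJ.symm) hlt
    have hcell := cell_mono hS (hX.start_le _ _ hpos)
    simp only [D, f, Finset.mem_sigma, Finset.mem_range, Finset.mem_product]
    refine ⟨Nat.lt_succ_of_le hcell, machine_mem_available hS hX hp, ?_⟩
    have h1 := lt_gridPoint_cell hS (X.start K)
    have h2 := gridPoint_cell_le hS hp
    rw [gridPoint_add_two] at h1
    have h3 : (off K : ℝ) ≤ _ := Nat.floor_le (div_nonneg (sub_nonneg.2 h2) I.p₂_pos.le)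
    have h4 : (X.start K - gridPoint ε I.p₁ (cell ε I.p₁ (X.start K) + 1)) / I.p₂ ≤
        ε * I.p₁ / I.p₂ := div_le_div_of_nonneg_right (by linarith) I.p₂_pos.le
    have h5 := lt_rounds hS
    have h6 : ((off K + 4 : ℕ) : ℝ) < rounds ε I := by push_cast; linarith
    have h7 : off K + 4 < rounds ε I := by exact_mod_cast h6
    omega
  have hne : ∀ K ∈ precedingLong ω X J, ∀ L ∈ precedingLong ω X J, X.pos K < X.pos L →
      f K ≠ f L := by
    intro K hK L hL hKL heq
    simp only [precedingLong, Finset.mem_filter, Finset.mem_univ, true_and] at hK hL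
    simp only [f, Sigma.mk.injEq, heq_eq_eq, Prod.mk.injEq] at heq
    obtain ⟨hc, hm, ho⟩ := heq
    have h1 := hX.free K L hKL hm
    rw [Input.duration, if_pos hK.2.2.1, hK.2.1, Input.size] at h1
    simp only [off, ← hc] at ho
    have h2 := gridPoint_cell_le hS hK.2.2.2
    have h3 : (X.start K - gridPoint ε I.p₁ (cell ε I.p₁ (X.start K) + 1)) / I.p₂ + 1 ≤
        (X.start L - gridPoint ε I.p₁ (cell ε I.p₁ (X.start K) + 1)) / I.p₂ := by
      rw [div_add_one I.p₂_pos.ne']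
      exact div_le_div_of_nonneg_right (by linarith) I.p₂_pos.le
    have h4 := Nat.floor_mono h3
    rw [Nat.floor_add_one (div_nonneg (sub_nonneg.2 h2) I.p₂_pos.le)] at h4
    omega
  have hinj : Set.InjOn f (precedingLong ω X J) := by
    intro K hK L hL heq
    by_contra hKL
    rcases lt_trichotomy (X.pos K) (X.pos L) with h | h | h
    · exact hne K hK L hL h heq
    · exact hKL (hX.pos_injective h)
    · exact hne L hL K hK h heq.symm
  have := Finset.card_le_card_of_injOn f hmem hinj
  simpa [D, Finset.card_sigma, Finset.card_product] using this

/-- By the end of the corresponding stretched interval there are sufficiently many slots. -/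
theorem card_precedingLong_lt (hS : Separated ε I) (hX : X.IsValid ω) (h : I.p₁ ≤ X.start J)
    (hJ : I.type J = .two) : (precedingLong ω X J).card <
      slotCount (available ε ω X) (rounds ε I) (cell ε I.p₁ (X.start J) + 1) := by
  refine (card_precedingLong_le hS hX hJ).trans_lt ?_
  have hr : 0 < rounds ε I := by
    have h1 := lt_rounds hS
    have h2 : 0 ≤ ε * I.p₁ / I.p₂ := div_nonneg hS.step_pos.le I.p₂_pos.le
    have h3 : (0 : ℝ) < rounds ε I := by linarith
    exact_mod_cast h3
  refine Finset.sum_lt_sum (fun j _ => Nat.mul_le_mul_left _ (Nat.sub_le _ _))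
    ⟨cell ε I.p₁ (X.start J), Finset.self_mem_range_succ _, ?_⟩
  exact Nat.mul_lt_mul_of_pos_left (by omega)
    (Finset.card_pos.2 ⟨_, machine_mem_available hS hX h⟩)

theorem slot_end_le (hS : Separated ε I) (b : ℕ) {r : ℕ} (hr : r < rounds ε I) :
    stretchedPoint ε I.p₁ (b + 1) + r * I.p₂ + I.p₂ ≤ stretchedPoint ε I.p₁ (b + 2) := by
  rw [stretchedPoint_add_two]
  have h1 := rounds_mul_le hS
  have h2 : ((r + 1 : ℕ) : ℝ) ≤ rounds ε I := by exact_mod_cast hr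
  have h3 := mul_le_mul_of_nonneg_right h2 I.p₂_pos.le
  push_cast at h3
  linarith

/-- The position of a late job of type two in the stratified schedule. -/
theorem exists_slot (hS : Separated ε I) (hX : X.IsValid ω) (h : I.p₁ ≤ X.start J)
    (hJ : I.type J = .two) : ∃ b r : ℕ,
      b = slotBlock (available ε ω X) (rounds ε I) (precedingLong ω X J).card ∧
      r = slotRound (available ε ω X) (rounds ε I) (precedingLong ω X J).card ∧
      newStart ε ω X J = stretchedPoint ε I.p₁ (b + 1) + r * I.p₂ ∧
      newMachine ε ω X J ∈ available ε ω X b ∧ b ≤ cell ε I.p₁ (X.start J) ∧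
      stretchedPoint ε I.p₁ (b + 1) ≤ newStart ε ω X J ∧
      newStart ε ω X J + I.p₂ ≤ stretchedPoint ε I.p₁ (b + 2) := by
  have hc := card_precedingLong_lt hS hX h hJ
  refine ⟨_, _, rfl, rfl, newStart_two h hJ, ?_, Nat.lt_succ_iff.1 (slotBlock_lt hc), ?_, ?_⟩
  · rw [newMachine_two h hJ]
    exact slotMember_mem hc _
  · rw [newStart_two h hJ]
    exact le_add_of_nonneg_right (mul_nonneg (Nat.cast_nonneg _) I.p₂_pos.le)
  · rw [newStart_two h hJ]
    exact slot_end_le hS _ (slotRound_lt hc)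

/-- Strictness matters: a type-two job precedes the type-one jobs of its own interval in the new
order. -/
theorem newStart_two_lt (hS : Separated ε I) (hX : X.IsValid ω) (h : I.p₁ ≤ X.start J)
    (hJ : I.type J = .two) :
    newStart ε ω X J < stretchedPoint ε I.p₁ (cell ε I.p₁ (X.start J) + 2) := by
  obtain ⟨b, r, -, -, -, -, hb, -, h2⟩ := exists_slot hS hX h hJ
  have := stretchedPoint_succ_mono hS (Nat.succ_le_succ hb)
  have := I.p₂_pos
  linarith

theorem newStart_le (hS : Separated ε I) (hX : X.IsValid ω) (h : I.p₁ ≤ X.start J) :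
    newStart ε ω X J ≤ stretchedPoint ε I.p₁ (cell ε I.p₁ (X.start J) + 2) := by
  cases hJ : I.type J with
  | one => exact (newStart_one h hJ).le
  | two => exact (newStart_two_lt hS hX h hJ).le

theorem stretchedPoint_one_le_newStart (hS : Separated ε I) (hX : X.IsValid ω)
    (h : I.p₁ ≤ X.start J) : stretchedPoint ε I.p₁ 1 ≤ newStart ε ω X J := by
  cases hJ : I.type J with
  | one =>
    rw [newStart_one h hJ]
    exact stretchedPoint_succ_mono hS (Nat.zero_le _)
  | two =>
    obtain ⟨b, r, -, -, -, -, -, h1, -⟩ := exists_slot hS hX h hJ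
    exact (stretchedPoint_succ_mono hS (Nat.zero_le b)).trans h1

theorem lt_newStart (hS : Separated ε I) (hX : X.IsValid ω) (h : I.p₁ ≤ X.start J) :
    I.p₁ < newStart ε ω X J := by
  have := stretchedPoint_one_le_newStart hS hX h
  have := p₁_le_stretchedPoint_one hS
  have := I.p₂_pos
  linarith

theorem newStart_nonneg (hS : Separated ε I) (hX : X.IsValid ω) (J : Fin I.N) :
    0 ≤ newStart ε ω X J := by
  rcases lt_or_ge (X.start J) I.p₁ with h | h
  · rw [newStart_early h]
    exact hX.start_nonneg J
  · exact I.p₁_pos.le.trans (lt_newStart hS hX h).le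

theorem newStart_mono (hS : Separated ε I) (hX : X.IsValid ω) (ht : I.type J = I.type K)
    (h : X.pos J < X.pos K) : newStart ε ω X J ≤ newStart ε ω X K := by
  have hs := hX.start_le _ _ h
  rcases lt_or_ge (X.start J) I.p₁ with hJ | hJ
  · rw [newStart_early hJ]
    rcases lt_or_ge (X.start K) I.p₁ with hK | hK
    · rwa [newStart_early hK]
    · exact hJ.le.trans (lt_newStart hS hX hK).le
  · have hK := hJ.trans hs
    cases hT : I.type J with
    | one =>
      rw [newStart_one hJ hT, newStart_one hK (ht ▸ hT)]
      exact stretchedPoint_succ_mono hS (Nat.succ_le_succ (cell_mono hS hs))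
    | two =>
      have hT' := ht ▸ hT
      have hcard : (precedingLong ω X J).card ≤ (precedingLong ω X K).card := by
        refine Finset.card_le_card fun L hL => ?_
        simp only [precedingLong, Finset.mem_filter, Finset.mem_univ, true_and] at hL ⊢
        exact ⟨hL.1.trans (hX.ordered _ _ ht h), hL.2⟩
      have hc := card_precedingLong_lt hS hX hK hT'
      obtain ⟨b, r, hb, hr, h1, -, -, h2, h3⟩ := exists_slot hS hX hJ hT
      obtain ⟨b', r', hb', hr', h1', -, -, h2', h3'⟩ := exists_slot hS hX hK hT'
      have hbb : b ≤ b' := by rw [hb, hb']; exact slotBlock_mono hcard hc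
      rcases hbb.eq_or_lt with heq | hlt
      · have hrr : r ≤ r' := by
          rw [hr, hr']
          exact slotRound_mono hcard (by rw [← hb, ← hb', heq])
        rw [h1, h1', heq]
        have : (r : ℝ) ≤ r' := by exact_mod_cast hrr
        have := mul_le_mul_of_nonneg_right this I.p₂_pos.le
        linarith
      · have := stretchedPoint_succ_mono hS (Nat.succ_le_of_lt hlt)
        have := I.p₂_pos
        linarith

theorem Before.start_le (h : Before ε ω X J K) : newStart ε ω X J ≤ newStart ε ω X K := by
  rcases h with h | h
  · exact h.le
  · exact h.1.le

theorem Before.asymm (h : Before ε ω X J K) (h' : Before ε ω X K J) : False := by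
  rcases h with h | h <;> rcases h' with h' | h'
  · exact lt_asymm h h'
  · exact h.ne' h'.1
  · exact h'.ne' h.1
  · exact lt_asymm h.2 h'.2

/-- Within a type, the order of starts is preserved. -/
theorem Before.pos_lt (hS : Separated ε I) (hX : X.IsValid ω) (ht : I.type J = I.type K)
    (h : Before ε ω X J K) : X.pos J < X.pos K := by
  by_contra! h'
  rcases h'.lt_or_eq with h1 | h1
  · exact h.asymm ((newStart_mono hS hX ht.symm h1).lt_or_eq.imp id fun h2 => ⟨h2, h1⟩)
  · rw [hX.pos_injective h1] at h
    exact h.asymm h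

/-- Jobs that start before `p₁` precede the others. -/
theorem Before.early (hS : Separated ε I) (hX : X.IsValid ω) (hK : X.start K < I.p₁)
    (h : Before ε ω X J K) : X.start J < I.p₁ ∧ X.pos J < X.pos K := by
  rcases lt_or_ge (X.start J) I.p₁ with hJ | hJ
  · refine ⟨hJ, ?_⟩
    rcases h with h | h
    · rw [newStart_early hJ, newStart_early hK] at h
      exact hX.pos_lt_of_start_lt h
    · exact h.2
  · have h1 := lt_newStart hS hX hJ
    have h2 := h.start_le
    rw [newStart_early hK] at h2
    linarith

theorem exists_sorted (ε : ℝ) (hX : X.IsValid ω) : ∃ l : List (Fin I.N), (∀ J, J ∈ l) ∧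
    l.Pairwise fun later earlier => Before ε ω X earlier later := by
  classical
  let key : Fin I.N → ℝ ×ₗ ℕ := fun J => toLex (newStart ε ω X J, X.pos J)
  have hinj : Function.Injective key := by
    intro J K h
    have h1 := congrArg (fun x => (ofLex x).2) h
    exact hX.pos_injective h1
  -- Reversed order, because schedules list the latest start first.
  let r : Fin I.N → Fin I.N → Prop := fun a b => key b ≤ key a
  have : Std.Total r := ⟨fun a b => le_total _ _⟩
  have : IsTrans (Fin I.N) r := ⟨fun a b c h1 h2 => le_trans h2 h1⟩
  refine ⟨(List.finRange I.N).insertionSort r, fun J => by simp, ?_⟩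
  have h1 := List.pairwise_insertionSort r (List.finRange I.N)
  have h2 : ((List.finRange I.N).insertionSort r).Nodup :=
    (List.perm_insertionSort r _).nodup_iff.2 (List.nodup_finRange _)
  refine (h1.and h2).imp ?_
  rintro a b ⟨hab, hne⟩
  have hlt : key b < key a := lt_of_le_of_ne hab fun h => hne (hinj h).symm
  exact Prod.Lex.toLex_lt_toLex.1 hlt

end Start

/-! ### Alignment, resting times and the stretch bound. -/

section Feasibility

variable {ε : ℝ} {I : Input} {ω : I.Realization} {X : Timetable I} {J K : Fin I.N}

/-- The integrality of `1 / ε` puts multiples of `p₂` on the grid of width `ε p₂`. -/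
theorem Separated.exists_mul_eq (hS : Separated ε I) (b : ℕ) :
    ∃ i : ℕ, (b : ℝ) * I.p₂ = i * (ε * I.p₂) := by
  obtain ⟨n, hn⟩ := hS.int
  refine ⟨b * n, ?_⟩
  push_cast
  rw [← hn]
  field_simp [hS.pos.ne']

theorem stretchedPoint_mem (k : ℕ) : stretchedPoint ε I.p₁ (k + 1) ∈
    startPoints ε I.p₁ I.p₂ .one := Or.inr ⟨k + 1, Nat.succ_pos k, rfl⟩

theorem startPoints_one_subset (hS : Separated ε I) :
    startPoints ε I.p₁ I.p₂ .one ⊆ startPoints ε I.p₁ I.p₂ .two := by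
  rintro t (ht | ⟨k, hk, rfl⟩)
  · exact Set.mem_iUnion.2 ⟨0, ht⟩
  · obtain ⟨k, rfl⟩ := Nat.exists_eq_add_of_le' hk
    refine Set.mem_iUnion.2 ⟨k + 1, 0, by simp, ?_⟩
    rw [stretchedPoint_add_two]
    have := hS.five_le
    have := I.p₂_pos
    have := hS.step_pos
    linarith

theorem mem_startPoints_of_early (hS : Separated ε I) (hX : X.IsValid ω) (h : X.start J < I.p₁) :
    X.start J ∈ startPoints ε I.p₁ I.p₂ .one := by
  obtain ⟨b, hb⟩ := hX.exists_multiple h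
  obtain ⟨i, hi⟩ := hS.exists_mul_eq b
  refine Or.inl ⟨i, ?_, ?_⟩
  · rw [hb, hi]
    simp [stretchedPoint, gridPoint]
  · have := p₁_le_stretchedPoint_one hS
    have := I.p₂_pos
    simp only [zero_add]
    linarith

theorem newStart_mem (hS : Separated ε I) (hX : X.IsValid ω) (J : Fin I.N) :
    newStart ε ω X J ∈ startPoints ε I.p₁ I.p₂ (I.type J) := by
  rcases lt_or_ge (X.start J) I.p₁ with h | h
  · rw [newStart_early h]
    have h1 := mem_startPoints_of_early hS hX h
    cases I.type J with
    | one => exact h1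
    | two => exact startPoints_one_subset hS h1
  · cases hT : I.type J with
    | one =>
      rw [newStart_one h hT]
      exact stretchedPoint_mem _
    | two =>
      obtain ⟨b, r, -, -, h1, -, -, -, h2⟩ := exists_slot hS hX h hT
      obtain ⟨i, hi⟩ := hS.exists_mul_eq r
      exact Set.mem_iUnion.2 ⟨b + 1, i, by rw [h1, hi], by linarith⟩

theorem newStart_mem_two (hS : Separated ε I) (hX : X.IsValid ω) (J : Fin I.N) :
    newStart ε ω X J ∈ startPoints ε I.p₁ I.p₂ .two := by
  have h := newStart_mem hS hX J
  cases hT : I.type J with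
  | one => exact startPoints_one_subset hS (hT ▸ h)
  | two => exact hT ▸ h

/-- A slot ends within its block and late type-one jobs start at block boundaries; two type-two jobs
on one machine are in different blocks or rounds, because the long job `J` raises the slot number of
`K`. -/
theorem newStart_add_le_of_two (hS : Separated ε I) (hX : X.IsValid ω) (h : Before ε ω X J K)
    (hm : newMachine ε ω X J = newMachine ε ω X K) (hω : ω J = true)
    (hK : I.p₁ ≤ X.start K) (hTJ : I.type J = .two) :
    newStart ε ω X J + I.p₂ ≤ newStart ε ω X K := by
  rcases lt_or_ge (X.start J) I.p₁ with hJ | hJ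
  · rw [newStart_early hJ]
    have := p₁_le_stretchedPoint_one hS
    have := stretchedPoint_one_le_newStart hS hX hK
    have := I.p₂_pos
    linarith
  · obtain ⟨b, r, hb, hr, h1, -, -, h2, h3⟩ := exists_slot hS hX hJ hTJ
    cases hTK : I.type K with
    | one =>
      have hlt : newStart ε ω X J < newStart ε ω X K := by
        rcases h with h | ⟨-, h⟩
        · exact h
        · rw [newStart_one hK hTK]
          exact (newStart_two_lt hS hX hJ hTJ).trans_le (stretchedPoint_succ_mono hS
            (Nat.succ_le_succ (cell_mono hS (hX.start_le _ _ h))))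
      rw [newStart_one hK hTK] at hlt ⊢
      exact h3.trans (stretchedPoint_succ_mono hS
        (Nat.succ_le_of_lt (lt_of_stretchedPoint_lt hS (h2.trans_lt hlt))))
    | two =>
      have hJK : J < K := hX.ordered _ _ (hTJ.trans hTK.symm)
        (h.pos_lt hS hX (hTJ.trans hTK.symm))
      have hcard : (precedingLong ω X J).card < (precedingLong ω X K).card := by
        refine Finset.card_lt_card ⟨fun L hL => ?_, fun hsub => ?_⟩
        · simp only [precedingLong, Finset.mem_filter, Finset.mem_univ, true_and] at hL ⊢
          exact ⟨hL.1.trans hJK, hL.2⟩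
        · have hmem : J ∈ precedingLong ω X K := by
            simp only [precedingLong, Finset.mem_filter, Finset.mem_univ, true_and]
            exact ⟨hJK, hTJ, hω, hJ⟩
          have := hsub hmem
          simp [precedingLong] at this
      have hc := card_precedingLong_lt hS hX hK hTK
      obtain ⟨b', r', hb', hr', h1', -, -, h2', h3'⟩ := exists_slot hS hX hK hTK
      have hbb : b ≤ b' := by rw [hb, hb']; exact slotBlock_mono hcard.le hc
      rcases hbb.eq_or_lt with heq | hlt
      · rw [newMachine_two hJ hTJ, newMachine_two hK hTK] at hm
        have hrr : r < r' := by
          rw [hr, hr']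
          exact slotRound_strictMono hcard hc (by rw [← hb, ← hb', heq]) hm
        rw [h1, h1', heq]
        have : ((r + 1 : ℕ) : ℝ) ≤ r' := by exact_mod_cast hrr
        have := mul_le_mul_of_nonneg_right this I.p₂_pos.le
        push_cast at this
        linarith
      · exact h3.trans ((stretchedPoint_succ_mono hS (Nat.succ_le_of_lt hlt)).trans h2')

/-- After a long job the machine rests until the next start point of its type. -/
theorem exists_rest_point (hS : Separated ε I) (hX : X.IsValid ω) (h : Before ε ω X J K)
    (hm : newMachine ε ω X J = newMachine ε ω X K) (hω : ω J = true) :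
    ∃ q ∈ startPoints ε I.p₁ I.p₂ (I.type J),
      newStart ε ω X J + I.size (I.type J) ≤ q ∧ q ≤ newStart ε ω X K := by
  rcases lt_or_ge (X.start K) I.p₁ with hK | hK
  · obtain ⟨hJ, hpos⟩ := h.early hS hX hK
    rw [newMachine_early hJ, newMachine_early hK] at hm
    have h1 := hX.free J K hpos hm
    rw [Input.duration, if_pos hω] at h1
    rw [newStart_early hJ, newStart_early hK]
    refine ⟨_, ?_, h1, le_rfl⟩
    have h2 := mem_startPoints_of_early hS hX hK
    cases I.type J with
    | one => exact h2
    | two => exact startPoints_one_subset hS h2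
  cases hTJ : I.type J with
  | two =>
    exact ⟨_, newStart_mem_two hS hX K, newStart_add_le_of_two hS hX h hm hω hK hTJ, le_rfl⟩
  | one =>
    rw [newMachine_one hTJ] at hm
    cases hTK : I.type K with
    | one =>
      rw [newMachine_one hTK] at hm
      refine ⟨_, hTK ▸ newStart_mem hS hX K, ?_, le_rfl⟩
      have h1 := hX.free J K (h.pos_lt hS hX (hTJ.trans hTK.symm)) hm
      rw [Input.duration, if_pos hω, hTJ] at h1
      have h2 := lt_gridPoint_cell hS (X.start K)
      rw [newStart_one hK hTK]
      simp only [Input.size] at h1 ⊢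
      rcases lt_or_ge (X.start J) I.p₁ with hJ | hJ
      · rw [newStart_early hJ]
        have h3 := gridPoint_add_two_le_stretchedPoint hS (cell ε I.p₁ (X.start K))
        have h4 := stretchedPoint_succ_mono hS (Nat.le_succ (cell ε I.p₁ (X.start K)))
        linarith
      · rw [newStart_one hJ hTJ]
        have h3 := gridPoint_cell_le hS hJ
        exact (stretchedPoint_add_le hS (by linarith)).trans
          (stretchedPoint_succ_mono hS (Nat.le_succ _))
    | two =>
      obtain ⟨b, r, -, -, -, hmem, -, h2, h3⟩ := exists_slot hS hX hK hTK
      -- The new start of `K` need not lie in `Q₁`, so the rest point is the beginning of its block.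
      refine ⟨_, stretchedPoint_mem b, ?_, h2⟩
      simp only [available, Finset.mem_filter, Finset.mem_univ, true_and] at hmem
      have h4 := hmem J hTJ hω hm
      simp only [Input.size]
      rcases lt_or_ge (X.start J) I.p₁ with hJ | hJ
      · have h5 : I.p₁ ≤ gridPoint ε I.p₁ (b + 1) := by
          rw [gridPoint_succ]
          exact le_add_of_nonneg_right (mul_nonneg (Nat.cast_nonneg _) hS.step_pos.le)
        rw [newStart_early hJ]
        exact (h4 (hJ.trans_le h5)).le.trans (gridPoint_add_two_le_stretchedPoint hS b)
      · have h5 := h.start_le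
        have h6 := I.p₂_pos
        rw [newStart_one hJ hTJ] at h5 ⊢
        -- `J` starts before the block of `K` ends, so its interval in `P` precedes interval `b` and
        -- the availability condition applies to it.
        have h7 := lt_of_stretchedPoint_lt hS
          (i := cell ε I.p₁ (X.start J) + 1) (j := b + 1) (by linarith)
        have h8 := (lt_gridPoint_cell hS (X.start J)).trans_le
          (gridPoint_succ_mono hS (Nat.lt_succ_iff.1 h7))
        have h9 := gridPoint_cell_le hS hJ
        exact stretchedPoint_add_le hS (by linarith [h4 h8])

theorem newStart_le_mul (hS : Separated ε I) (hX : X.IsValid ω) (J : Fin I.N) :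
    newStart ε ω X J ≤ (1 + 3 * (1 + ε) * ε) * (1 + 5 * ε) * X.start J := by
  have h0 := hS.pos
  -- The construction loses only `1 + ε` besides the stretch: one grid step `ε p₁` is at most `ε`
  -- times a start time of at least `p₁`.
  have hge : 1 + ε ≤ 1 + 3 * (1 + ε) * ε := by nlinarith
  have hle : (1 + ε) * ((1 + 5 * ε) * X.start J) ≤
      (1 + 3 * (1 + ε) * ε) * ((1 + 5 * ε) * X.start J) :=
    mul_le_mul_of_nonneg_right hge (mul_nonneg hS.factor_pos.le (hX.start_nonneg J))
  rw [mul_assoc]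
  refine le_trans ?_ hle
  rcases lt_or_ge (X.start J) I.p₁ with h | h
  · rw [newStart_early h]
    have h1 := hX.start_nonneg J
    have h2 : X.start J ≤ (1 + 5 * ε) * X.start J := by nlinarith
    nlinarith
  · refine (newStart_le hS hX h).trans ?_
    rw [stretchedPoint, gridPoint_add_two]
    have h1 := gridPoint_cell_le hS h
    have h2 := mul_le_mul_of_nonneg_left h hS.pos.le
    rw [mul_left_comm]
    exact mul_le_mul_of_nonneg_left (by linarith) hS.factor_pos.le

end Feasibility

/-! ### Non-anticipation of the new schedule. -/

section NonAnticipation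

variable {ε : ℝ} {I : Input} {ω ω' : I.Realization} {X X' : Timetable I}

/-- The two timetables coincide before time `s`. -/
def AgreeBefore (ω ω' : I.Realization) (X X' : Timetable I) (s : ℝ) : Prop :=
  ∀ K, X.start K < s ∨ X'.start K < s →
    X'.start K = X.start K ∧ X'.machine K = X.machine K ∧ ω' K = ω K

theorem AgreeBefore.symm {s : ℝ} (h : AgreeBefore ω ω' X X' s) : AgreeBefore ω' ω X' X s :=
  fun K hK => let ⟨h1, h2, h3⟩ := h K hK.symm; ⟨h1.symm, h2.symm, h3.symm⟩

theorem AgreeBefore.available_subset {s : ℝ} (h : AgreeBefore ω ω' X X' s) {j : ℕ}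
    (hj : gridPoint ε I.p₁ (j + 1) ≤ s) : available ε ω X j ⊆ available ε ω' X' j := by
  intro i hi
  simp only [available, Finset.mem_filter, Finset.mem_univ, true_and] at hi ⊢
  intro J hT hω hm hs
  obtain ⟨h1, h2, h3⟩ := h J (Or.inr (hs.trans_le hj))
  rw [h1] at hs ⊢
  exact hi J hT (h3 ▸ hω) (h2 ▸ hm) hs

theorem AgreeBefore.available_eq {s : ℝ} (h : AgreeBefore ω ω' X X' s) {j : ℕ}
    (hj : gridPoint ε I.p₁ (j + 1) ≤ s) : available ε ω X j = available ε ω' X' j :=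
  (h.available_subset hj).antisymm (h.symm.available_subset hj)

/-- Agreement up to `s ≥ p₁` settles which jobs start before `p₁`; their exact later start times are
irrelevant. -/
theorem AgreeBefore.precedingLong_subset {s : ℝ} (h : AgreeBefore ω ω' X X' s) (hs : I.p₁ ≤ s)
    {J : Fin I.N} (hJ : ∀ K < J, I.type K = .two → ω' K = ω K) :
    precedingLong ω X J ⊆ precedingLong ω' X' J := by
  intro K hK
  simp only [precedingLong, Finset.mem_filter, Finset.mem_univ, true_and] at hK ⊢
  obtain ⟨h1, h2, h3, h4⟩ := hK
  refine ⟨h1, h2, (hJ K h1 h2).trans h3, ?_⟩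
  by_contra! h5
  rw [(h K (Or.inr (h5.trans_le hs))).1] at h5
  exact absurd h4 h5.not_ge

/-- By `hlt` the slot of `J` lies in a block that begins, on the original grid, no later than `s`,
so all availability sets involved agree. -/
theorem AgreeBefore.new_eq (hS : Separated ε I) (hX : X.IsValid ω) {s : ℝ}
    (h : AgreeBefore ω ω' X X' s) (hs : I.p₁ ≤ s) {J : Fin I.N} (hT : I.type J = .two)
    (hJ : ∀ K < J, I.type K = .two → ω' K = ω K) (hl : I.p₁ ≤ X.start J)
    (hl' : I.p₁ ≤ X'.start J)
    (hlt : newStart ε ω X J < stretchedPoint ε I.p₁ (cell ε I.p₁ s + 2)) :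
    newMachine ε ω' X' J = newMachine ε ω X J ∧ newStart ε ω' X' J = newStart ε ω X J := by
  have hpl : precedingLong ω' X' J = precedingLong ω X J :=
    (h.symm.precedingLong_subset hs fun K h1 h2 => (hJ K h1 h2).symm).antisymm
      (h.precedingLong_subset hs hJ)
  have hc := card_precedingLong_lt hS hX hl hT
  obtain ⟨b, r, hb, -, -, -, -, h2, -⟩ := exists_slot hS hX hl hT
  have hbs := lt_of_stretchedPoint_lt hS (h2.trans_lt hlt)
  have hF : ∀ j ≤ slotBlock (available ε ω X) (rounds ε I) (precedingLong ω X J).card,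
      available ε ω X j = available ε ω' X' j := by
    intro j hj
    rw [← hb] at hj
    exact h.available_eq
      ((gridPoint_succ_mono hS (hj.trans (Nat.lt_succ_iff.1 hbs))).trans (gridPoint_cell_le hS hs))
  rw [newMachine_two hl hT, newMachine_two hl' hT, newStart_two hl hT, newStart_two hl' hT, hpl,
    slotMember_congr hc hF, slotBlock_congr hc hF, slotRound_congr hc hF]
  exact ⟨rfl, rfl⟩

/-- The next start of the stratified schedule depends only on the jobs started before. -/
theorem next_start_eq (hS : Separated ε I) (hX : X.IsValid ω) (hX' : X'.IsValid ω')
    (hna : ∀ J, (∀ K, X.pos K < X.pos J → ω K = ω' K) →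
      X'.start J = X.start J ∧ X'.machine J = X.machine J ∧ X'.pos J = X.pos J)
    (hna' : ∀ J, (∀ K, X'.pos K < X'.pos J → ω' K = ω K) →
      X.start J = X'.start J ∧ X.machine J = X'.machine J ∧ X.pos J = X'.pos J)
    (A : Set (Fin I.N)) (hA : ∀ K ∈ A, ω K = ω' K) {J J' : Fin I.N} (hJ : J ∉ A) (hJ' : J' ∉ A)
    (hmin : ∀ K, K ∉ A → K ≠ J → Before ε ω X J K)
    (hmin' : ∀ K, K ∉ A → K ≠ J' → Before ε ω' X' J' K) :
    J' = J ∧ newMachine ε ω' X' J' = newMachine ε ω X J ∧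
      newStart ε ω' X' J' = newStart ε ω X J := by
  classical
  -- `A` holds the jobs already started in the new schedule; `u` and `u'` are the first jobs outside
  -- `A` in the two original runs.
  have hne : (Finset.univ.filter fun K => K ∉ A).Nonempty := ⟨J, by simp [hJ]⟩
  obtain ⟨u, huA, hu⟩ := Finset.exists_min_image _ X.pos hne
  obtain ⟨u', huA', hu'⟩ := Finset.exists_min_image _ X'.pos hne
  simp only [Finset.mem_filter, Finset.mem_univ, true_and] at huA hu huA' hu'
  have hlow : ∀ K, X.pos K < X.pos u → K ∈ A := fun K hK => by
    by_contra h
    exact absurd hK (hu K h).not_gt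
  have hlow' : ∀ K, X'.pos K < X'.pos u' → K ∈ A := fun K hK => by
    by_contra h
    exact absurd hK (hu' K h).not_gt
  have hcom : ∀ K, X.pos K ≤ X.pos u →
      X'.start K = X.start K ∧ X'.machine K = X.machine K ∧ X'.pos K = X.pos K :=
    fun K hK => hna K fun L hL => hA L (hlow L (hL.trans_le hK))
  have hcom' : ∀ K, X'.pos K ≤ X'.pos u' →
      X.start K = X'.start K ∧ X.machine K = X'.machine K ∧ X.pos K = X'.pos K :=
    fun K hK => hna' K fun L hL => (hA L (hlow' L (hL.trans_le hK))).symm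
  -- All predecessors of `u` and of `u'` lie in `A`, so both have equal positions in the two runs,
  -- and minimality makes them coincide.
  obtain rfl : u = u' := by
    apply hX.pos_injective
    have h1 := hu u' huA'
    have h2 := hu' u huA
    have h3 := (hcom u le_rfl).2.2
    have h4 := (hcom' u' le_rfl).2.2
    omega
  obtain ⟨hus, hum, hup⟩ := hcom u le_rfl
  have hagree : AgreeBefore ω ω' X X' (X.start u) := by
    rintro K (hK | hK)
    · have h1 := hX.pos_lt_of_start_lt hK
      exact ⟨(hcom K h1.le).1, (hcom K h1.le).2.1, (hA K (hlow K h1)).symm⟩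
    · rw [← hus] at hK
      have h1 := hX'.pos_lt_of_start_lt hK
      exact ⟨(hcom' K h1.le).1.symm, (hcom' K h1.le).2.1.symm, (hA K (hlow' K h1)).symm⟩
  have hstart : ∀ K, K ∉ A → X.start u ≤ X.start K := fun K hK => by
    rcases (hu K hK).lt_or_eq with h | h
    · exact hX.start_le _ _ h
    · rw [hX.pos_injective h]
  have hstart' : ∀ K, K ∉ A → X'.start u ≤ X'.start K := fun K hK => by
    rcases (hu' K hK).lt_or_eq with h | h
    · exact hX'.start_le _ _ h
    · rw [hX'.pos_injective h]
  rcases lt_or_ge (X.start u) I.p₁ with hlate | hlate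
  · have hJu : J = u := by
      by_contra h
      exact absurd ((hmin u huA (Ne.symm h)).early hS hX hlate).2 (hu J hJ).not_gt
    have hJu' : J' = u := by
      by_contra h
      exact absurd ((hmin' u huA (Ne.symm h)).early hS hX' (hus ▸ hlate)).2 (hu' J' hJ').not_gt
    subst hJu hJu'
    rw [newStart_early hlate, newMachine_early hlate, newStart_early (hus ▸ hlate),
      newMachine_early (hus ▸ hlate)]
    exact ⟨rfl, hum, hus⟩
  have hlate' : I.p₁ ≤ X'.start u := hus ▸ hlate
  -- A type-one job other than `u` comes after `u`: by index order if `u` has type one, otherwise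
  -- because `u` starts strictly before the end of its stretched interval.
  have hone : I.type J = .one → J = u := by
    intro hT
    by_contra hne
    have hB := hmin u huA (Ne.symm hne)
    cases hTu : I.type u with
    | one => exact absurd (hB.pos_lt hS hX (hT.trans hTu.symm)) (hu J hJ).not_gt
    | two =>
      have h1 := hB.start_le
      rw [newStart_one (hlate.trans (hstart J hJ)) hT] at h1
      have h2 := newStart_two_lt hS hX hlate hTu
      have h3 := stretchedPoint_succ_mono hS (Nat.succ_le_succ (cell_mono hS (hstart J hJ)))
      exact absurd (h1.trans_lt h2) (not_lt.2 h3)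
  have hone' : I.type J' = .one → J' = u := by
    intro hT
    by_contra hne
    have hB := hmin' u huA (Ne.symm hne)
    cases hTu : I.type u with
    | one => exact absurd (hB.pos_lt hS hX' (hT.trans hTu.symm)) (hu' J' hJ').not_gt
    | two =>
      have h1 := hB.start_le
      rw [newStart_one (hlate'.trans (hstart' J' hJ')) hT] at h1
      have h2 := newStart_two_lt hS hX' hlate' hTu
      have h3 := stretchedPoint_succ_mono hS (Nat.succ_le_succ (cell_mono hS (hstart' J' hJ')))
      exact absurd (h1.trans_lt h2) (not_lt.2 h3)
  have hprev : I.type J = .two → ∀ K < J, I.type K = .two → K ∈ A := by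
    intro hT K hK hTK
    by_contra h
    have h1 := (hmin K h hK.ne).pos_lt hS hX (hT.trans hTK.symm)
    exact absurd hK (hX.ordered _ _ (hT.trans hTK.symm) h1).not_gt
  have hprev' : I.type J' = .two → ∀ K < J', I.type K = .two → K ∈ A := by
    intro hT K hK hTK
    by_contra h
    have h1 := (hmin' K h hK.ne).pos_lt hS hX' (hT.trans hTK.symm)
    exact absurd hK (hX'.ordered _ _ (hT.trans hTK.symm) h1).not_gt
  have hlt : I.type J = .two →
      newStart ε ω X J < stretchedPoint ε I.p₁ (cell ε I.p₁ (X.start u) + 2) := by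
    intro hT
    by_cases hJu : J = u
    · rw [← hJu]
      exact newStart_two_lt hS hX (hJu ▸ hlate) hT
    · rcases hmin u huA (Ne.symm hJu) with h | h
      · exact h.trans_le (newStart_le hS hX hlate)
      · exact absurd h.2 (hu J hJ).not_gt
  have hlt' : I.type J' = .two →
      newStart ε ω' X' J' < stretchedPoint ε I.p₁ (cell ε I.p₁ (X.start u) + 2) := by
    intro hT
    rw [← hus]
    by_cases hJu : J' = u
    · rw [← hJu]
      exact newStart_two_lt hS hX' (hJu ▸ hlate') hT
    · rcases hmin' u huA (Ne.symm hJu) with h | h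
      · exact h.trans_le (newStart_le hS hX' hlate')
      · exact absurd h.2 (hu' J' hJ').not_gt
  have hnew : I.type J = .two →
      newMachine ε ω' X' J = newMachine ε ω X J ∧ newStart ε ω' X' J = newStart ε ω X J :=
    fun hT => hagree.new_eq hS hX hlate hT (fun K h1 h2 => (hA K (hprev hT K h1 h2)).symm)
      (hlate.trans (hstart J hJ)) (hlate'.trans (hstart' J hJ)) (hlt hT)
  have hnew' : I.type J' = .two →
      newMachine ε ω X J' = newMachine ε ω' X' J' ∧ newStart ε ω X J' = newStart ε ω' X' J' :=
    fun hT => hagree.symm.new_eq hS hX' hlate hT (fun K h1 h2 => hA K (hprev' hT K h1 h2))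
      (hlate'.trans (hstart' J' hJ')) (hlate.trans (hstart J' hJ')) (hlt' hT)
  have hu_one : I.type u = .one → newMachine ε ω' X' u = newMachine ε ω X u ∧
      newStart ε ω' X' u = newStart ε ω X u := by
    intro hT
    rw [newMachine_one hT, newMachine_one hT, newStart_one hlate hT, newStart_one hlate' hT, hus]
    exact ⟨hum, rfl⟩
  cases hT : I.type J with
  | one =>
    have hJu := hone hT
    have hJJ : J' = J := by
      cases hT' : I.type J' with
      | one => rw [hone' hT', hJu]
      | two =>
        by_contra hne
        -- Here `J'` would have the same slot in the first run and start strictly before `u = J`,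
        -- contradicting the choice of `J`.
        have h1 := (hmin J' hJ' hne).start_le
        rw [(hnew' hT').2, hJu, newStart_one hlate (hJu ▸ hT)] at h1
        exact absurd (hlt' hT') h1.not_gt
    rw [hJJ, hJu]
    exact ⟨rfl, hu_one (hJu ▸ hT)⟩
  | two =>
    have hJJ : J' = J := by
      cases hT' : I.type J' with
      | one =>
        have hJu' := hone' hT'
        by_contra hne
        have h1 := (hmin' J hJ (Ne.symm hne)).start_le
        rw [(hnew hT).2, hJu', newStart_one hlate' (hJu' ▸ hT'), hus] at h1
        exact absurd (hlt hT) h1.not_gt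
      | two =>
        rcases lt_trichotomy J' J with h | h | h
        · exact absurd (hprev hT J' h hT') hJ'
        · exact h
        · exact absurd (hprev' hT' J h hT) hJ
    rw [hJJ]
    exact ⟨rfl, hnew hT⟩

end NonAnticipation

/-! ### Assembly of the policy. -/

section Main

variable {ε : ℝ} {I : Input}

/-- The entry of a job in the stratified schedule. -/
noncomputable def newEntry (ε : ℝ) {I : Input} (ω : I.Realization) (X : Timetable I)
    (J : Fin I.N) : StartedJob I :=
  ⟨J, newMachine ε ω X J, newStart ε ω X J, ω J⟩

theorem Before.compatible (hS : Separated ε I) {ω : I.Realization} {X : Timetable I}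
    (hX : X.IsValid ω) {J K : Fin I.N} (h : Before ε ω X J K) :
    Compatible (newEntry ε ω X K) (newEntry ε ω X J) := by
  refine ⟨h.start_le, ?_, fun hm => ?_⟩
  · rintro (rfl : J = K)
    exact h.asymm h
  · change newStart ε ω X J + (if ω J = true then I.size (I.type J) else 0) ≤ newStart ε ω X K
    split_ifs with hω
    · obtain ⟨q, -, h1, h2⟩ := exists_rest_point hS hX h hm hω
      exact h1.trans h2
    · simpa using h.start_le

theorem exists_stratified_policy (hS : Separated ε I) (P : Policy I)
    (hP_nonIdling : P.NonIdling) (hP_order : P.StartsInIndexOrder) :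
    ∃ R : Policy I, R.IsStratified (startPoints ε I.p₁ I.p₂) I.size ∧
      ∀ (ω : I.Realization) (S T : Schedule I), P.HasSchedule ω S → R.HasSchedule ω T →
        ∀ e ∈ S, ∀ f ∈ T, f.job = e.job →
          f.start ≤ (1 + 3 * (1 + ε) * ε) * (1 + 5 * ε) * e.start := by
  obtain ⟨X, hX, hna, hstart⟩ := P.exists_timetable hP_nonIdling hP_order
  have hex : ∀ ω, ∃ l : List (Fin I.N), 0 < I.prob ω → (∀ J, J ∈ l) ∧
      l.Pairwise fun later earlier => Before ε ω (X ω) earlier later := by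
    intro ω
    by_cases hω : 0 < I.prob ω
    · obtain ⟨l, hl⟩ := exists_sorted ε (hX ω hω)
      exact ⟨l, fun _ => hl⟩
    · exact ⟨[], fun h => absurd h hω⟩
  choose l hl using hex
  let T : I.Realization → Schedule I := fun ω => (l ω).map (newEntry ε ω (X ω))
  have hT : ∀ ω, ∀ e ∈ T ω, e = newEntry ε ω (X ω) e.job := by
    intro ω e he
    obtain ⟨J, -, rfl⟩ := List.mem_map.1 he
    rfl
  have hmem : ∀ ω, 0 < I.prob ω → ∀ J, newEntry ε ω (X ω) J ∈ T ω :=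
    fun ω hω J => List.mem_map_of_mem ((hl ω hω).1 J)
  have hbefore : ∀ ω, 0 < I.prob ω →
      (T ω).Pairwise fun b a => Before ε ω (X ω) a.job b.job :=
    fun ω hω => List.pairwise_map.2 (hl ω hω).2
  have hpair : ∀ ω, 0 < I.prob ω → (T ω).Pairwise Compatible :=
    fun ω hω => List.pairwise_map.2 ((hl ω hω).2.imp fun h => h.compatible hS (hX ω hω))
  have hnext : ∀ ω (hω : 0 < I.prob ω) h e, (e :: h) <:+ T ω →
      (∀ f ∈ h, f.job ≠ e.job) ∧
      ∀ K, (∀ f ∈ h, f.job ≠ K) → K ≠ e.job → Before ε ω (X ω) e.job K := by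
    intro ω hω h e hs
    refine ⟨fun f hf => ((List.pairwise_cons.1
      ((hpair ω hω).sublist hs.sublist)).1 f hf).2.1, fun K hK hne => ?_⟩
    obtain ⟨a, ha⟩ := hs
    have h1 := hmem ω hω K
    have h2 := hbefore ω hω
    rw [← ha] at h1 h2
    rcases List.mem_append.1 h1 with h3 | h3
    · exact (List.pairwise_append.1 h2).2.2 _ h3 e List.mem_cons_self
    · rcases List.mem_cons.1 h3 with h4 | h4
      · exact absurd (congrArg StartedJob.job h4) hne
      · exact absurd rfl (hK _ h4)
  obtain ⟨R, hR⟩ := exists_policy_of_schedules T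
    (fun ω hω J => ⟨_, hmem ω hω J, rfl⟩)
    (fun ω hω e he => by rw [hT ω e he]; rfl)
    (fun ω hω e he => by rw [hT ω e he]; exact newStart_nonneg hS (hX ω hω) _)
    hpair
    (by
      intro ω ω' hω hω' h e e' hs hs'
      obtain ⟨h1, h2⟩ := hnext ω hω h e hs
      obtain ⟨h1', h2'⟩ := hnext ω' hω' h e' hs'
      -- The entries of the common history `h` record the outcomes, so both realizations agree on
      -- its jobs.
      have hag : ∀ K ∈ {K | ∃ f ∈ h, f.job = K}, ω K = ω' K := by
        rintro K ⟨f, hf, rfl⟩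
        have h3 := hT ω f (hs.subset (List.mem_cons_of_mem _ hf))
        have h4 := hT ω' f (hs'.subset (List.mem_cons_of_mem _ hf))
        exact (congrArg StartedJob.long h3).symm.trans (congrArg StartedJob.long h4)
      have h3 := next_start_eq hS (hX ω hω) (hX ω' hω') (hna ω ω' hω hω') (hna ω' ω hω' hω)
        {K | ∃ f ∈ h, f.job = K} hag (J := e.job) (J' := e'.job)
        (by rintro ⟨f, hf, hfe⟩; exact h1 f hf hfe) (by rintro ⟨f, hf, hfe⟩; exact h1' f hf hfe)
        (fun K hK => h2 K fun f hf hfK => hK ⟨f, hf, hfK⟩)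
        (fun K hK => h2' K fun f hf hfK => hK ⟨f, hf, hfK⟩)
      have he := hT ω e (hs.subset List.mem_cons_self)
      have he' := hT ω' e' (hs'.subset List.mem_cons_self)
      exact ⟨h3.1, (congrArg StartedJob.machine he').trans
        (h3.2.1.trans (congrArg StartedJob.machine he).symm),
        (congrArg StartedJob.start he').trans
        (h3.2.2.trans (congrArg StartedJob.start he).symm)⟩)
  refine ⟨R, ⟨?_, ?_, ?_⟩, ?_⟩
  · intro ω S hSch e he
    rw [hR ω S hSch] at he
    rw [hT ω e he]
    exact newStart_mem hS (hX ω hSch.1) _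
  · rintro ω S hSch e he hlong e₂ he₂ hm ⟨h1, h2⟩
    rw [hR ω S hSch] at he he₂
    have hE := hT ω e he
    have hE₂ := hT ω e₂ he₂
    have hω : ω e.job = true := (congrArg StartedJob.long hE).symm.trans hlong
    have hcomp : e.completion = newStart ε ω (X ω) e.job + I.size (I.type e.job) := by
      rw [StartedJob.completion, if_pos hlong, congrArg StartedJob.start hE]
      rfl
    have hstart₂ : e₂.start = newStart ε ω (X ω) e₂.job := congrArg StartedJob.start hE₂
    have hsize := I.size_pos (I.type e.job)
    have hB : Before ε ω (X ω) e.job e₂.job :=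
      Or.inl (by rw [hcomp, hstart₂] at h1; linarith)
    obtain ⟨q, hq, h3, h4⟩ := exists_rest_point hS (hX ω hSch.1) hB
      ((congrArg StartedJob.machine hE).symm.trans
        (hm.symm.trans (congrArg StartedJob.machine hE₂))) hω
    -- The threshold is harmless: a long job started at a nonnegative time completes no earlier than
    -- its size.
    have hInf : sInf {t | t ∈ startPoints ε I.p₁ I.p₂ (I.type e.job) ∧
        max (I.size (I.type e.job)) e.completion ≤ t} ≤ q := by
      refine csInf_le ⟨e.completion, fun t ht => (le_max_right _ _).trans ht.2⟩ ⟨hq, ?_⟩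
      have := newStart_nonneg hS (hX ω hSch.1) e.job
      rw [hcomp]
      exact max_le (by linarith) h3
    exact absurd h2 (not_lt.2 (hInf.trans (h4.trans_eq hstart₂.symm)))
  · intro ω S hSch
    rw [hR ω S hSch]
    refine (hbefore ω hSch.1).imp fun {b a} h ht => ?_
    exact (hX ω hSch.1).ordered _ _ ht.symm (h.pos_lt hS (hX ω hSch.1) ht.symm)
  · intro ω S S' hSP hSR e he f hf hfe
    rw [hR ω S' hSR] at hf
    rw [hstart ω S hSP e he, ← hfe, congrArg StartedJob.start (hT ω f hf)]
    exact newStart_le_mul hS (hX ω hSP.1) _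

theorem stretch_factor_isBigO :
    (fun x : ℝ => (1 + 3 * (1 + x) * x) * (1 + 5 * x) - 1) =O[nhds 0] (fun x : ℝ => x) := by
  have h : (fun x : ℝ => (1 + 3 * (1 + x) * x) * (1 + 5 * x) - 1) =
      fun x => (8 + 18 * x + 15 * x ^ 2) * x := by
    funext x
    ring
  rw [h]
  have hc : Continuous fun x : ℝ => 8 + 18 * x + 15 * x ^ 2 := by fun_prop
  simpa using (hc.tendsto 0).isBigO_one ℝ |>.mul (Asymptotics.isBigO_refl (fun x : ℝ => x) (nhds 0))

end Main

end TwoTypeScheduling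

open TwoTypeScheduling in
theorem mainTheorem6 (ε : ℝ) (hε_pos : 0 < ε) (hε_le : ε ≤ 3 / 10)
    (hε_int : ∃ k : ℕ, 1 / ε = k)
    (I : Input) (hsep : I.p₂ ≤ ε ^ 2 * I.p₁)
    (P : Policy I) (hP_nonIdling : P.NonIdling) (hP_order : P.StartsInIndexOrder) :
    (∃ R : Policy I,
      R.IsStratified (startPoints ε I.p₁ I.p₂) I.size ∧
      ∀ (ω : I.Realization) (S T : Schedule I), P.HasSchedule ω S → R.HasSchedule ω T →
        ∀ e ∈ S, ∀ f ∈ T, f.job = e.job →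
          f.start ≤ (1 + 3 * (1 + ε) * ε) * (1 + 5 * ε) * e.start) ∧
    (fun x : ℝ => (1 + 3 * (1 + x) * x) * (1 + 5 * x) - 1) =O[nhds 0] (fun x : ℝ => x) := by
  exact ⟨exists_stratified_policy ⟨hε_pos, hε_le, hε_int, hsep⟩ P hP_nonIdling hP_order,
    stretch_factor_isBigO⟩
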